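/- Let $\Omega=[a,b]\times[c,d]$ with $a<b$, $c<d$, let $a=x_0<\dots<x_m=b$ and $c=y_0<\dots<y_n=d$ be partitions ($m,n\ge 1$), and put $x_i=x_0$ for $i<0$, $x_i=x_m$ for $i>m$, and likewise for $y$. Put $h_i=x_i-x_{i-1}$, $k_j=y_j-y_{j-1}$, $s_i=\frac12(x_{i-1}+x_i)$, $t_j=\frac12(y_{j-1}+y_j)$, $M_{i,j}=(s_i,t_j)$, $A_{i,j}=(x_i,y_j)$, and let $h$ and $\delta$ be the maximum and the minimum of the steplengths $h_i$ ($1\le i\le m$), $k_j$ ($1\le j\le n$). The criss-cross triangulation $\mathcal T_{mn}$ is obtained by drawing both diagonals in each subrectangle $[x_{r-1},x_r]\times[y_{s-1},y_s]$. Let $B_{ij}$ ($0\le i\le m+1$, $0\le j\le n+1$) be the $C^1$ piecewise quadratic B-splines on $\mathcal T_{mn}$ with multiple knots on $\partial\Omega$: on each subrectangle, the Bernstein–Bézier coefficients of $B_{ij}$ at its vertices and at the midpoints of its edges are the products of those of $N_i(x)$ and $N_j(y)$, where $N_0,\dots,N_{m+1}$ and $N_0,\dots,N_{n+1}$ denote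 the univariate quadratic B-splines (summing to one) for the two partitions with triple end knots; the coefficient at the midpoint of each half-diagonal is the mean of those at the midpoints of the two adjacent edges, and the coefficient at the centre is the mean of the four edge-midpoint coefficients. Let $Qf=\sum_{i=0}^{m+1}\sum_{j=0}^{n+1}\lambda_{ij}(f)B_{ij}$ be one of the following two quasi-interpolants. * $Q=S_2$: $\lambda_{ij}(f)=(1-a_i-c_i-\bar a_j-\bar c_j)f(M_{i,j})+a_if(M_{i-1,j})+c_if(M_{i+1,j})+\bar a_jf(M_{i,j-1})+\bar c_jf(M_{i,j+1})$, where $a_i=-\frac{\sigma_i^2\sigma_{i+1}'}{\sigma_i+\sigma_{i+1}'}$ and $c_i=-\frac{\sigma_i(\sigma_{i+1}')^2}{\sigma_i+\sigma_{i+1}'}$ for $1\le i\le m$, with $\sigma_i=\frac{h_i}{h_{i-1}+h_i}$, $\sigma_i'=\frac{h_{i-1}}{h_{i-1}+h_i}$; $a_0=c_0=a_{m+1}=c_{m+1}=0$; and $\bar a_j,\bar c_j$ are defined in the same way from the $k_j$. (Terms with coefficient $0$ are omitted.) * $Q=W_2^*$: $\lambda_{ij}(f)=2f(M_{i,j})-\frac14\left[f(A_{i-1,j-1})+f(A_{i-1,j})+f(A_{i,j-1})+f(A_{i,j})\right]$.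 Let $D^\alpha=\partial^{|\alpha|}/\partial x^{\alpha_1}\partial y^{\alpha_2}$ (one-sided on the boundary), let $\omega(\psi,t)=\max\{|\psi(M)-\psi(P)|: M,P\in\Omega,\ \|M-P\|\le t\}$ with the Euclidean norm, and let $\omega(D^sf,t)=\max_{|\alpha|=s}\omega(D^\alpha f,t)$. **Theorem.** For every $\gamma>1$ there is a constant $C>0$ depending only on $\gamma$ such that, for every $\gamma$-quasi-uniform sequence (or family) of such partitions of $\Omega$, i.e. $h/\delta\le\gamma$ for each of its members, the following hold for each member of the sequence. (i) If $f\in C^s(\Omega)$ with $s\in\{1,2\}$, then $Qf\in C^1(\Omega)$ and, for $|\alpha|=1$, $$\|D^\alpha f-D^\alpha Qf\|_{\Omega}\le C\,h^{s-1}\,\omega(D^sf,h/2).$$ (ii) If $f\in C^2(\Omega)$ then, for every triangular cell $T$ of the triangulation, $Qf$ is $C^2$ in the interior of $T$ and, for $|\alpha|=2$, $$\|D^\alpha f-D^\alpha Qf\|_{\mathrm{int}(T)}\le C\,\omega(D^2f,h/2).$$ Here $\|\cdot\|$ denotes the supremum norm over the indicated set. Consequently, if $h\to0$ along the sequence, then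 $D^\alpha Qf\to D^\alpha f$ uniformly on $\Omega$ for $|\alpha|=1$ and $f\in C^1(\Omega)$; and, for $|\alpha|=2$ and $f\in C^2(\Omega)$, $D^\alpha Qf\to D^\alpha f$ in the interiors of the triangular cells, uniformly over all cells. -/

import Mathlib

open Filter Topology

noncomputable section

namespace CrissCross

/-- A partition `a = x₀ < x₁ < ⋯ < x_m = b` of the segment `[a, b]`
(the values `knot i` with `i > m` are irrelevant). -/
structure Partition (a b : ℝ) where
  m : ℕ
  knot : ℕ → ℝ
  knot_zero : knot 0 = a
  knot_last : knot m = b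
  knot_lt : ∀ i < m, knot i < knot (i + 1)

namespace Partition

variable {a b : ℝ} (X : Partition a b)

/-- The knots with the end points repeated: `x_i = x₀` for `i < 0` and `x_i = x_m` for `i > m`. -/
def x (i : ℤ) : ℝ := X.knot (min i.toNat X.m)

/-- The steps `h_i = x_i - x_{i-1}`; in particular `h₀ = h_{m+1} = 0`. -/
def h (i : ℤ) : ℝ := X.x i - X.x (i - 1)

/-- The midpoints `s_i = (x_{i-1} + x_i) / 2`; in particular `s₀ = x₀` and `s_{m+1} = x_m`. -/
def s (i : ℤ) : ℝ := (X.x (i - 1) + X.x i) / 2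

/-- `σ_i = h_i / (h_{i-1} + h_i)`, used for `1 ≤ i ≤ m + 1`; `σ₁ = 1` and `σ_{m+1} = 0`. -/
def σ (i : ℤ) : ℝ := X.h i / (X.h (i - 1) + X.h i)

/-- `σ'_i = h_{i-1} / (h_{i-1} + h_i)`, used for `1 ≤ i ≤ m + 1`; `σ'₁ = 0` and `σ'_{m+1} = 1`. -/
def σ' (i : ℤ) : ℝ := X.h (i - 1) / (X.h (i - 1) + X.h i)

/-- The coefficient `a_i`, with `a₀ = a_{m+1} = 0`. -/
def ca (i : ℤ) : ℝ :=
  if 1 ≤ i ∧ i ≤ X.m then -(X.σ i ^ 2 * X.σ' (i + 1)) / (X.σ i + X.σ' (i + 1)) else 0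

/-- The coefficient `c_i`, with `c₀ = c_{m+1} = 0`. -/
def cc (i : ℤ) : ℝ :=
  if 1 ≤ i ∧ i ≤ X.m then -(X.σ i * X.σ' (i + 1) ^ 2) / (X.σ i + X.σ' (i + 1)) else 0

/-- The value at the knot `x_r` (`0 ≤ r ≤ m`) of the `i`-th univariate quadratic B-spline `N_i`,
`0 ≤ i ≤ m + 1`, with triple knots at the end points: `N_i` is the `C¹` piecewise quadratic function
supported in `[x_{i-2}, x_{i+1}]`, and the `N_i` sum to one. -/
def vtx (i r : ℤ) : ℝ :=
  if i = r then X.σ (r + 1) else if i = r + 1 then X.σ' (r + 1) else 0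

/-- The middle Bernstein-Bézier coefficient of `N_i` on `[x_{r-1}, x_r]`, `1 ≤ r ≤ m`. The outer two
coefficients there are the values `vtx i (r - 1)` and `vtx i r` at the end points. -/
def mid (_X : Partition a b) (i r : ℤ) : ℝ := if i = r then 1 else 0

open Classical in
/-- The number `r ∈ {1, …, m}` of a subinterval `[x_{r-1}, x_r]` that contains `t ∈ [a, b]`. -/
def cell (t : ℝ) : ℤ := 1 + (((Finset.Ico 1 X.m).filter fun i => X.knot i ≤ t).card : ℤ)

/-- The maximal step `max {h_i : 1 ≤ i ≤ m}`. -/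
def maxStep : ℝ := ⨆ i : Fin X.m, X.h ((i : ℕ) + 1)

/-- The minimal step `min {h_i : 1 ≤ i ≤ m}`. -/
def minStep : ℝ := ⨅ i : Fin X.m, X.h ((i : ℕ) + 1)

end Partition

/-- The quadratic polynomial on a triangle with Bernstein-Bézier coefficients `b₁, b₂, b₃` at the
vertices and `b₁₂, b₁₃, b₂₃` at the midpoints of the edges, in barycentric coordinates. -/
def bernstein (b₁ b₂ b₃ b₁₂ b₁₃ b₂₃ l₁ l₂ l₃ : ℝ) : ℝ :=
  b₁ * l₁ ^ 2 + b₂ * l₂ ^ 2 + b₃ * l₃ ^ 2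
    + 2 * b₁₂ * l₁ * l₂ + 2 * b₁₃ * l₁ * l₃ + 2 * b₂₃ * l₂ * l₃

/-- The piecewise quadratic function on the unit square, cut into four triangles by its diagonals,
with Bernstein-Bézier coefficients `b₀₀, b₁₀, b₀₁, b₁₁` at the corners and `eS, eN, eW, eE` at the
midpoints of the lower, upper, left and right edge. `C¹` smoothness across the diagonals forces the
coefficient at the midpoint of a half-diagonal to be the mean of those at the midpoints of the two
adjacent edges, and the coefficient at the centre to be the mean of the four edge coefficients. -/
def square (b₀₀ b₁₀ b₀₁ b₁₁ eS eN eW eE u v : ℝ) : ℝ :=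
  if v ≤ u then
    if u + v ≤ 1 then
      bernstein b₀₀ b₁₀ ((eS + eN + eW + eE) / 4) eS ((eS + eW) / 2) ((eS + eE) / 2)
        (1 - u - v) (u - v) (2 * v)
    else
      bernstein b₁₀ b₁₁ ((eS + eN + eW + eE) / 4) eE ((eS + eE) / 2) ((eN + eE) / 2)
        (u - v) (u + v - 1) (2 * (1 - u))
  else
    if u + v ≤ 1 then
      bernstein b₀₀ b₀₁ ((eS + eN + eW + eE) / 4) eW ((eS + eW) / 2) ((eN + eW) / 2)
        (1 - u - v) (v - u) (2 * u)
    else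
      bernstein b₀₁ b₁₁ ((eS + eN + eW + eE) / 4) eN ((eN + eW) / 2) ((eN + eE) / 2)
        (v - u) (u + v - 1) (2 * (1 - v))

/-- The rectangle `Ω = [a, b] × [c, d]`. -/
def rect (a b c d : ℝ) : Set (ℝ × ℝ) := Set.Icc a b ×ˢ Set.Icc c d

/-- A grid `X_m × Y_n` on the rectangle `[a, b] × [c, d]`. -/
structure Grid (a b c d : ℝ) where
  X : Partition a b
  Y : Partition c d

namespace Grid

variable {a b c d : ℝ} (P : Grid a b c d)

/-- The maximal steplength of the grid. -/
def maxStep : ℝ := max P.X.maxStep P.Y.maxStep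

/-- The minimal steplength of the grid. -/
def minStep : ℝ := min P.X.minStep P.Y.minStep

/-- The grid points `A_{ij} = (x_i, y_j)`, with the repeated end knots for indices outside the range. -/
def A (i j : ℤ) : ℝ × ℝ := (P.X.x i, P.Y.x j)

/-- The points `M_{ij} = (s_i, t_j)`. -/
def M (i j : ℤ) : ℝ × ℝ := (P.X.s i, P.Y.s j)

/-- The closed triangular cells of the criss-cross triangulation: each subrectangle
`[x_{r-1}, x_r] × [y_{s-1}, y_s]` is cut into four triangles by its two diagonals. -/
def IsCell (T : Set (ℝ × ℝ)) : Prop :=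
  ∃ r s : ℤ, (1 ≤ r ∧ r ≤ P.X.m) ∧ (1 ≤ s ∧ s ≤ P.Y.m) ∧
    (T = convexHull ℝ {P.A (r - 1) (s - 1), P.A r (s - 1), P.M r s} ∨
     T = convexHull ℝ {P.A r (s - 1), P.A r s, P.M r s} ∨
     T = convexHull ℝ {P.A r s, P.A (r - 1) s, P.M r s} ∨
     T = convexHull ℝ {P.A (r - 1) s, P.A (r - 1) (s - 1), P.M r s})

/-- The restriction to `Ω` of the `C¹` quadratic B-spline `B_{ij}` on the criss-cross triangulation,
`0 ≤ i ≤ m + 1`, `0 ≤ j ≤ n + 1`, with multiple knots on the boundary of `Ω`, given by its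
Bernstein-Bézier coefficients on the subrectangle `[x_{r-1}, x_r] × [y_{s-1}, y_s]` that contains the
point. On every grid line `B_{ij}` is a multiple of a univariate quadratic B-spline; its coefficients
at grid points and at midpoints of grid edges are the products of those of `N_i(x)` and `N_j(y)`. -/
def B (i j : ℤ) (p : ℝ × ℝ) : ℝ :=
  let r := P.X.cell p.1
  let s := P.Y.cell p.2
  square
    (P.X.vtx i (r - 1) * P.Y.vtx j (s - 1)) (P.X.vtx i r * P.Y.vtx j (s - 1))
    (P.X.vtx i (r - 1) * P.Y.vtx j s) (P.X.vtx i r * P.Y.vtx j s)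
    (P.X.mid i r * P.Y.vtx j (s - 1)) (P.X.mid i r * P.Y.vtx j s)
    (P.X.vtx i (r - 1) * P.Y.mid j s) (P.X.vtx i r * P.Y.mid j s)
    ((p.1 - P.X.x (r - 1)) / P.X.h r) ((p.2 - P.Y.x (s - 1)) / P.Y.h s)

/-- The coefficient functionals `μ_{ij}` of the quasi-interpolant `S₂`. -/
def μS (i j : ℤ) (f : ℝ × ℝ → ℝ) : ℝ :=
  (1 - (P.X.ca i + P.X.cc i + P.Y.ca j + P.Y.cc j)) * f (P.M i j)
    + P.X.ca i * f (P.M (i - 1) j) + P.X.cc i * f (P.M (i + 1) j)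
    + P.Y.ca j * f (P.M i (j - 1)) + P.Y.cc j * f (P.M i (j + 1))

/-- The coefficient functionals `μ*_{ij}` of the modified Chui-Wang quasi-interpolant `W₂*`. -/
def μW (i j : ℤ) (f : ℝ × ℝ → ℝ) : ℝ :=
  2 * f (P.M i j)
    - 1 / 4 * (f (P.A (i - 1) (j - 1)) + f (P.A (i - 1) j) + f (P.A i (j - 1)) + f (P.A i j))

end Grid

/-- The two quasi-interpolants. -/
inductive Kind
  | S₂
  | W₂star

/-- The coefficient functionals `λ_{ij}` of a quasi-interpolant. -/
def Kind.coeff {a b c d : ℝ} (Q : Kind) (P : Grid a b c d) (i j : ℤ) (f : ℝ × ℝ → ℝ) : ℝ :=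
  match Q with
  | .S₂ => P.μS i j f
  | .W₂star => P.μW i j f

/-- The quasi-interpolant `Q f = ∑_{i=0}^{m+1} ∑_{j=0}^{n+1} λ_{ij}(f) B_{ij}`. -/
def Kind.apply {a b c d : ℝ} (Q : Kind) (P : Grid a b c d) (f : ℝ × ℝ → ℝ) (p : ℝ × ℝ) : ℝ :=
  ∑ i ∈ Finset.Icc (0 : ℤ) (P.X.m + 1), ∑ j ∈ Finset.Icc (0 : ℤ) (P.Y.m + 1),
    Q.coeff P i j f * P.B i j p

/-- The partial derivative `D^{(1,0)}` in the rectangle (one-sided on the vertical edges). -/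
def partialX (a b : ℝ) (f : ℝ × ℝ → ℝ) (p : ℝ × ℝ) : ℝ :=
  derivWithin (fun t => f (t, p.2)) (Set.Icc a b) p.1

/-- The partial derivative `D^{(0,1)}` in the rectangle (one-sided on the horizontal edges). -/
def partialY (c d : ℝ) (f : ℝ × ℝ → ℝ) (p : ℝ × ℝ) : ℝ :=
  derivWithin (fun t => f (p.1, t)) (Set.Icc c d) p.2

/-- The partial derivative `D^α`, `α = (α₁, α₂)`, in the rectangle `[a, b] × [c, d]`. -/
def partialD (a b c d : ℝ) (α : ℕ × ℕ) (f : ℝ × ℝ → ℝ) : ℝ × ℝ → ℝ :=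
  (partialX a b)^[α.1] ((partialY c d)^[α.2] f)

/-- The modulus of continuity of `ψ` on `Ω`, for the Euclidean distance. -/
def modulus (Ω : Set (ℝ × ℝ)) (ψ : ℝ × ℝ → ℝ) (t : ℝ) : ℝ :=
  sSup {e | ∃ p ∈ Ω, ∃ q ∈ Ω, √((p.1 - q.1) ^ 2 + (p.2 - q.2) ^ 2) ≤ t ∧ e = |ψ p - ψ q|}

/-- `ω(D^s f, t) = max {ω(D^α f, t) : |α| = s}` on the rectangle `[a, b] × [c, d]`. -/
def modulusD (a b c d : ℝ) (s : ℕ) (f : ℝ × ℝ → ℝ) (t : ℝ) : ℝ :=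
  (Finset.HasAntidiagonal.antidiagonal s).sup' ⟨(0, s), by simp⟩
    fun α => modulus (rect a b c d) (partialD a b c d α f) t

/-- A `γ`-quasi-uniform family of grids. -/
def QuasiUniform {a b c d : ℝ} {ι : Type} (γ : ℝ) (P : ι → Grid a b c d) : Prop :=
  ∀ k, (P k).maxStep / (P k).minStep ≤ γ

end CrissCross

end

open CrissCross

open CrissCross

/-! The argument is local reproduction plus stability. On a subrectangle a spline `∑ φ i j * B i j`
is determined by eight Bernstein-Bézier coefficients, `Grid.net`, each a convex combination of `φ i
j` with `i`, `j` within one of the box indices. Its first and second derivatives are linear in this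
net, with bounded coefficients in the unit square.

Reproduction: both functionals send a quadratic polynomial to its blossom values, `x ↦ s_i`, `x² ↦
x_{i-1} x_i`, `xy ↦ s_i t_j` (`Grid.coeff_quad`), and the B-spline weights turn these into the
Bernstein-Bézier net of the same polynomial (`Grid.net_coeff_quad`). Stability: a coefficient
functional has norm at most 9 and uses only nodes within three maximal steps `H` of the box.

Fix `p` and write `f = q + g`, with `q` the Taylor polynomial of `f` at `p` of degree one or two.
The `q` part of the net gives exactly the derivatives of `f` at `p`. If `|g| ≤ K` near `p`, the rest
is a net of size at most `9 * K`, whose derivatives of order `k` are at most a constant times `K`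
divided by `k` steplengths, hence at most `γ ^ k * K / H ^ k` up to a constant. Taylor's formula
gives `K` of order `H ^ s * ω(D^s f, H / 2)`, the several multiples of `H / 2` being absorbed by
chaining the modulus along a segment.

For `C¹` smoothness, each piece is written with squared positive parts, so it is differentiable
across the diagonals; the weights `σ`, `σ'` make value and gradient agree across grid lines
(`Grid.jet_glue_left`, `Grid.jet_glue_below`). On a triangle the positive parts are linear or zero,
so the piece is a polynomial there and its second derivatives are constant. -/

namespace CrissCross

/-! ### Univariate partitions, B-spline weights and the moments of the `S₂` coefficients -/

namespace Partition

variable {a b : ℝ} (X : Partition a b)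

theorem one_le_m (hab : a < b) : 1 ≤ X.m := by
  rcases Nat.eq_zero_or_pos X.m with h | h
  · have h1 := X.knot_last
    rw [h, X.knot_zero] at h1
    exact absurd h1 hab.ne
  · exact h

theorem knot_le {i j : ℕ} (hij : i ≤ j) (hj : j ≤ X.m) : X.knot i ≤ X.knot j := by
  induction j, hij using Nat.le_induction with
  | base => exact le_rfl
  | succ n hn ih => exact (ih (by omega)).trans (X.knot_lt n (by omega)).le

theorem x_mono : Monotone X.x := fun i j hij =>
  X.knot_le (by omega) (by omega)

theorem x_natCast {i : ℕ} (hi : i ≤ X.m) : X.x i = X.knot i := by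
  simp [x, hi]

theorem x_of_nonpos {i : ℤ} (hi : i ≤ 0) : X.x i = a := by
  simp [x, Int.toNat_of_nonpos hi, X.knot_zero]

theorem x_of_ge {i : ℤ} (hi : (X.m : ℤ) ≤ i) : X.x i = b := by
  have : min i.toNat X.m = X.m := by omega
  simp [x, this, X.knot_last]

theorem x_mem (i : ℤ) : X.x i ∈ Set.Icc a b := by
  constructor
  · have := X.knot_le (Nat.zero_le (min i.toNat X.m)) (by omega)
    rwa [X.knot_zero] at this
  · have := X.knot_le (i := min i.toNat X.m) (j := X.m) (by omega) le_rfl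
    rwa [X.knot_last] at this

theorem h_nonneg (i : ℤ) : 0 ≤ X.h i := sub_nonneg.2 (X.x_mono (by omega))

theorem h_pos {i : ℤ} (h1 : 1 ≤ i) (h2 : i ≤ X.m) : 0 < X.h i := by
  obtain ⟨k, rfl⟩ : ∃ k : ℕ, i = ((k + 1 : ℕ) : ℤ) := ⟨(i - 1).toNat, by omega⟩
  have h3 : ((k + 1 : ℕ) : ℤ) - 1 = (k : ℕ) := by push_cast; ring
  rw [h, h3, X.x_natCast (by omega), X.x_natCast (by omega)]
  exact sub_pos.2 (X.knot_lt k (by omega))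

theorem h_le_maxStep {i : ℤ} (h1 : 1 ≤ i) (h2 : i ≤ X.m) : X.h i ≤ X.maxStep := by
  obtain ⟨k, rfl⟩ : ∃ k : ℕ, i = (k : ℤ) + 1 := ⟨(i - 1).toNat, by omega⟩
  exact le_ciSup (f := fun i : Fin X.m => X.h ((i : ℕ) + 1)) (Set.finite_range _).bddAbove
    ⟨k, by omega⟩

theorem minStep_le_h {i : ℤ} (h1 : 1 ≤ i) (h2 : i ≤ X.m) : X.minStep ≤ X.h i := by
  obtain ⟨k, rfl⟩ : ∃ k : ℕ, i = (k : ℤ) + 1 := ⟨(i - 1).toNat, by omega⟩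
  exact ciInf_le (f := fun i : Fin X.m => X.h ((i : ℕ) + 1)) (Set.finite_range _).bddBelow
    ⟨k, by omega⟩

theorem minStep_pos (hab : a < b) : 0 < X.minStep := by
  have : Nonempty (Fin X.m) := ⟨⟨0, X.one_le_m hab⟩⟩
  obtain ⟨i, hi⟩ := exists_eq_ciInf_of_finite (f := fun i : Fin X.m => X.h ((i : ℕ) + 1))
  rw [minStep, ← hi]
  exact X.h_pos (by omega) (by omega)

theorem maxStep_pos (hab : a < b) : 0 < X.maxStep :=
  (X.h_pos le_rfl (by exact_mod_cast X.one_le_m hab)).trans_le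
    (X.h_le_maxStep le_rfl (by exact_mod_cast X.one_le_m hab))

theorem h_le (hab : a < b) (i : ℤ) : X.h i ≤ X.maxStep := by
  by_cases h1 : 1 ≤ i
  · by_cases h2 : i ≤ X.m
    · exact X.h_le_maxStep h1 h2
    · rw [h, X.x_of_ge (i := i) (by omega), X.x_of_ge (i := i - 1) (by omega), sub_self]
      exact (X.maxStep_pos hab).le
  · rw [h, X.x_of_nonpos (i := i) (by omega), X.x_of_nonpos (i := i - 1) (by omega), sub_self]
    exact (X.maxStep_pos hab).le

theorem x_sub_x_le (hab : a < b) (i : ℤ) (n : ℕ) : X.x (i + n) - X.x i ≤ n * X.maxStep := by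
  induction n with
  | zero => simp
  | succ n ih =>
    have h1 := X.h_le hab (i + (n + 1 : ℕ))
    rw [h, show i + ((n + 1 : ℕ) : ℤ) - 1 = i + n by push_cast; ring] at h1
    push_cast at h1 ⊢
    linarith

/-- `cell` counts the interior knots up to `t`, so intervals are closed on the left and open on the
right, except that the last one also contains its right end. -/
theorem cell_eq {t : ℝ} {r : ℕ} (h1 : 1 ≤ r) (h2 : r ≤ X.m) (ht : X.knot (r - 1) ≤ t)
    (ht' : r = X.m ∨ t < X.knot r) : X.cell t = r := by
  classical
  have : (Finset.Ico 1 X.m).filter (fun i => X.knot i ≤ t) = Finset.Ico 1 r := by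
    ext i
    simp only [Finset.mem_filter, Finset.mem_Ico]
    constructor
    · rintro ⟨⟨h3, h4⟩, h5⟩
      refine ⟨h3, ?_⟩
      rcases ht' with h6 | h6
      · omega
      · by_contra h7
        exact absurd (X.knot_le (i := r) (j := i) (by omega) (by omega)) (by linarith)
    · rintro ⟨h3, h4⟩
      exact ⟨⟨h3, by omega⟩, (X.knot_le (by omega) (by omega)).trans ht⟩
  rw [cell]
  convert (by omega : (1 : ℤ) + ((r - 1 : ℕ) : ℤ) = r) using 3
  rw [← Nat.card_Ico, ← this]

theorem exists_interval (hab : a < b) {t : ℝ} (ht : t ∈ Set.Icc a b) :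
    ∃ r : ℕ, 1 ≤ r ∧ r ≤ X.m ∧ X.knot (r - 1) ≤ t ∧ (r = X.m ∨ t < X.knot r) := by
  classical
  set r := Nat.findGreatest (fun r => X.knot (r - 1) ≤ t) X.m with hr
  have hm := X.one_le_m hab
  have h0 : X.knot (1 - 1) ≤ t := by simpa [X.knot_zero] using ht.1
  have h1 : 1 ≤ r := Nat.le_findGreatest hm h0
  refine ⟨r, h1, Nat.findGreatest_le _, Nat.findGreatest_spec (P := fun r => X.knot (r - 1) ≤ t)
    hm h0, ?_⟩
  by_contra! h2
  have h3 : r ≤ X.m := Nat.findGreatest_le _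
  have := Nat.le_findGreatest (P := fun r => X.knot (r - 1) ≤ t) (n := X.m) (m := r + 1)
    (by omega) (by simpa using h2.2)
  omega

theorem cell_spec (hab : a < b) {t : ℝ} (ht : t ∈ Set.Icc a b) :
    (1 ≤ X.cell t ∧ X.cell t ≤ X.m) ∧ t ∈ Set.Icc (X.x (X.cell t - 1)) (X.x (X.cell t)) := by
  obtain ⟨r, h1, h2, h3, h4⟩ := X.exists_interval hab ht
  rw [X.cell_eq h1 h2 h3 h4, X.x_natCast h2, show (r : ℤ) - 1 = ((r - 1 : ℕ) : ℤ) by omega,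
    X.x_natCast (by omega)]
  refine ⟨⟨by omega, by omega⟩, h3, ?_⟩
  rcases h4 with h4 | h4
  · rw [h4, X.knot_last]; exact ht.2
  · exact h4.le

/-- The closed intervals overlap only at interior knots, where `cell` picks the interval on the
right. This is the only ambiguity that the gluing lemmas have to resolve. -/
theorem cell_eq_or {t : ℝ} {r : ℤ} (h1 : 1 ≤ r) (h2 : r ≤ X.m)
    (ht : t ∈ Set.Icc (X.x (r - 1)) (X.x r)) :
    X.cell t = r ∨ (t = X.x r ∧ X.cell t = r + 1 ∧ r < X.m) := by
  obtain ⟨k, rfl⟩ : ∃ k : ℕ, r = (k : ℤ) := ⟨r.toNat, by omega⟩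
  rw [show (k : ℤ) - 1 = ((k - 1 : ℕ) : ℤ) by omega, X.x_natCast (by omega),
    X.x_natCast (by omega)] at ht
  by_cases hk : k = X.m ∨ t < X.knot k
  · exact Or.inl (X.cell_eq (by omega) (by omega) ht.1 hk)
  · push Not at hk
    have hkm : k < X.m := by omega
    right
    rw [X.x_natCast (by omega)]
    refine ⟨le_antisymm ht.2 hk.2, ?_, by omega⟩
    have := X.cell_eq (t := t) (r := k + 1) (by omega) (by omega) (by simpa using hk.2)
      (Or.inr (ht.2.trans_lt (X.knot_lt k hkm)))
    exact_mod_cast this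

/-- The value at `x_r` of the univariate spline with coefficients `φ`. -/
noncomputable def val (r : ℤ) (φ : ℤ → ℝ) : ℝ := X.σ (r + 1) * φ r + X.σ' (r + 1) * φ (r + 1)

theorem sum_vtx {r : ℤ} (h0 : 0 ≤ r) (hr : r ≤ X.m) (φ : ℤ → ℝ) :
    ∑ i ∈ Finset.Icc (0 : ℤ) (X.m + 1), φ i * X.vtx i r = X.val r φ := by
  have h1 : ∀ i ∈ Finset.Icc (0 : ℤ) (X.m + 1), φ i * X.vtx i r
      = (if i = r then φ r * X.σ (r + 1) else 0)
        + (if i = r + 1 then φ (r + 1) * X.σ' (r + 1) else 0) := by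
    intro i _
    unfold vtx
    by_cases h2 : i = r
    · subst h2; simp
    · by_cases h3 : i = r + 1
      · subst h3; simp
      · simp [h2, h3]
  rw [Finset.sum_congr rfl h1, Finset.sum_add_distrib, Finset.sum_ite_eq', Finset.sum_ite_eq',
    if_pos (Finset.mem_Icc.2 ⟨h0, by omega⟩), if_pos (Finset.mem_Icc.2 ⟨by omega, by omega⟩), val]
  ring

theorem sum_mid {r : ℤ} (h0 : 0 ≤ r) (hr : r ≤ X.m + 1) (φ : ℤ → ℝ) :
    ∑ i ∈ Finset.Icc (0 : ℤ) (X.m + 1), φ i * X.mid i r = φ r := by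
  simp only [mid, mul_ite, mul_one, mul_zero]
  rw [Finset.sum_ite_eq', if_pos (Finset.mem_Icc.2 ⟨h0, hr⟩)]

theorem h_add_pos (hab : a < b) {r : ℤ} (h0 : 0 ≤ r) (hr : r ≤ X.m) : 0 < X.h r + X.h (r + 1) := by
  have hm := X.one_le_m hab
  by_cases h1 : 1 ≤ r
  · linarith [X.h_pos h1 hr, X.h_nonneg (r + 1)]
  · linarith [X.h_pos (i := r + 1) (by omega) (by omega), X.h_nonneg r]

theorem σ_nonneg (i : ℤ) : 0 ≤ X.σ i :=
  div_nonneg (X.h_nonneg _) (add_nonneg (X.h_nonneg _) (X.h_nonneg _))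

theorem σ'_nonneg (i : ℤ) : 0 ≤ X.σ' i :=
  div_nonneg (X.h_nonneg _) (add_nonneg (X.h_nonneg _) (X.h_nonneg _))

theorem σ_le_one (i : ℤ) : X.σ i ≤ 1 :=
  div_le_one_of_le₀ (by linarith [X.h_nonneg (i - 1)])
    (add_nonneg (X.h_nonneg _) (X.h_nonneg _))

theorem σ'_le_one (i : ℤ) : X.σ' i ≤ 1 :=
  div_le_one_of_le₀ (by linarith [X.h_nonneg i])
    (add_nonneg (X.h_nonneg _) (X.h_nonneg _))

theorem σ_add_σ' (hab : a < b) {r : ℤ} (h0 : 0 ≤ r) (hr : r ≤ X.m) :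
    X.σ (r + 1) + X.σ' (r + 1) = 1 := by
  have := X.h_add_pos hab h0 hr
  rw [σ, σ', show r + 1 - 1 = r by ring]
  field_simp
  ring

/-- The lever law: `x_r` divides the segment from `s_r` to `s_{r+1}` in the ratio of the adjacent
steps. It gives both the reproduction of polynomials and the `C¹` match at grid lines. -/
theorem σ_mul_h (hab : a < b) {r : ℤ} (h0 : 0 ≤ r) (hr : r ≤ X.m) :
    X.σ (r + 1) * X.h r = X.σ' (r + 1) * X.h (r + 1) := by
  have := X.h_add_pos hab h0 hr
  rw [σ, σ', show r + 1 - 1 = r by ring]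
  field_simp

theorem abs_val_le (hab : a < b) {r : ℤ} (h0 : 0 ≤ r) (hr : r ≤ X.m) {φ : ℤ → ℝ} {K : ℝ}
    (h1 : |φ r| ≤ K) (h2 : |φ (r + 1)| ≤ K) : |X.val r φ| ≤ K := by
  have h3 := X.σ_add_σ' hab h0 hr
  rw [val]
  have h4 := X.σ_nonneg (r + 1)
  have h5 := X.σ'_nonneg (r + 1)
  rw [abs_le] at *
  constructor <;> nlinarith

theorem val_s (hab : a < b) {r : ℤ} (h0 : 0 ≤ r) (hr : r ≤ X.m) (t : ℝ) :
    X.val r (fun i => X.s i - t) = X.x r - t := by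
  have h1 := X.σ_add_σ' hab h0 hr
  have h2 := X.σ_mul_h hab h0 hr
  simp only [val, s, h, show r + 1 - 1 = r by ring] at *
  linear_combination (X.x r - t) * h1 - h2 / 2

/-- Marsden's identity at a knot: both products contain the factor `x_r - t`, and the weighted mean
of the other factors is `x_r - t` again by the lever law. -/
theorem val_x_mul_x (hab : a < b) {r : ℤ} (h0 : 0 ≤ r) (hr : r ≤ X.m) (t : ℝ) :
    X.val r (fun i => (X.x (i - 1) - t) * (X.x i - t)) = (X.x r - t) ^ 2 := by
  have h1 := X.σ_add_σ' hab h0 hr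
  have h2 := X.σ_mul_h hab h0 hr
  simp only [val, h, show r + 1 - 1 = r by ring] at *
  linear_combination (X.x r - t) ^ 2 * h1 - (X.x r - t) * h2

theorem abs_ca_le (i : ℤ) : |X.ca i| ≤ 1 := by
  unfold ca
  split_ifs
  · have h1 := X.σ_nonneg i
    have h2 := X.σ'_nonneg (i + 1)
    have h3 := X.σ_le_one i
    have h4 := X.σ'_le_one (i + 1)
    rw [neg_div, abs_neg, abs_of_nonneg (by positivity)]
    refine div_le_one_of_le₀ ?_ (by positivity)
    nlinarith [mul_nonneg h1 h2, mul_nonneg (mul_nonneg h1 h2) (sub_nonneg.2 h3),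
      mul_nonneg h1 (sub_nonneg.2 h4)]
  · simp

theorem abs_cc_le (i : ℤ) : |X.cc i| ≤ 1 := by
  unfold cc
  split_ifs
  · have h1 := X.σ_nonneg i
    have h2 := X.σ'_nonneg (i + 1)
    have h3 := X.σ_le_one i
    have h4 := X.σ'_le_one (i + 1)
    rw [neg_div, abs_neg, abs_of_nonneg (by positivity)]
    refine div_le_one_of_le₀ ?_ (by positivity)
    nlinarith [mul_nonneg h1 h2, mul_nonneg (mul_nonneg h1 h2) (sub_nonneg.2 h4),
      mul_nonneg h1 (sub_nonneg.2 h4)]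
  · simp

/-- The distances from `s_i` to its neighbours are `h_i / (2 σ_i)` and `h_i / (2 σ'_{i+1})`, so the
two first moments are opposite. -/
theorem moment_one (i : ℤ) :
    X.ca i * (X.s (i - 1) - X.s i) + X.cc i * (X.s (i + 1) - X.s i) = 0 := by
  unfold ca cc
  split_ifs with hi
  · have h1 := X.h_pos hi.1 hi.2
    have h2 := X.h_nonneg (i - 1)
    have h3 := X.h_nonneg (i + 1)
    have e1 : X.s (i - 1) - X.s i = -(X.h (i - 1) + X.h i) / 2 := by simp only [s, h]; ring
    have e2 : X.s (i + 1) - X.s i = (X.h i + X.h (i + 1)) / 2 := by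
      simp only [s, h, show i + 1 - 1 = i by ring]; ring
    have h4 : X.h (i - 1) + X.h i ≠ 0 := by positivity
    have h5 : X.h i + X.h (i + 1) ≠ 0 := by positivity
    rw [e1, e2, σ, σ', show i + 1 - 1 = i by ring]
    field_simp
    ring
  · simp

/-- With the same distances the sum is `-h_i² / 4`. This is the correction that turns `s_i²`, the
value of `x²` at the node, into the blossom value `x_{i-1} x_i`. -/
theorem moment_two (i : ℤ) (hi : 0 ≤ i) (hi' : i ≤ X.m + 1) :
    X.ca i * (X.s (i - 1) - X.s i) ^ 2 + X.cc i * (X.s (i + 1) - X.s i) ^ 2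
      = -(X.x i - X.x (i - 1)) ^ 2 / 4 := by
  unfold ca cc
  split_ifs with hi
  · have h1 := X.h_pos hi.1 hi.2
    have h2 := X.h_nonneg (i - 1)
    have h3 := X.h_nonneg (i + 1)
    have e1 : X.s (i - 1) - X.s i = -(X.h (i - 1) + X.h i) / 2 := by simp only [s, h]; ring
    have e2 : X.s (i + 1) - X.s i = (X.h i + X.h (i + 1)) / 2 := by
      simp only [s, h, show i + 1 - 1 = i by ring]; ring
    have h4 : X.h (i - 1) + X.h i ≠ 0 := by positivity
    have h5 : X.h i + X.h (i + 1) ≠ 0 := by positivity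
    have h6 : X.σ i ≠ 0 := by rw [σ]; positivity
    have h7 : X.σ i + X.σ' (i + 1) ≠ 0 := by
      have := X.σ_nonneg i
      have := X.σ'_nonneg (i + 1)
      positivity
    have e3 : X.σ i * (X.h (i - 1) + X.h i) = X.h i := by rw [σ]; field_simp
    have e4 : X.σ' (i + 1) * (X.h i + X.h (i + 1)) = X.h i := by
      rw [σ', show i + 1 - 1 = i by ring]; field_simp
    rw [e1, e2, ← h]
    field_simp
    linear_combination (-4 * X.σ' (i + 1)) * (X.σ i * (X.h (i - 1) + X.h i) + X.h i) * e3
      - 4 * X.σ i * (X.σ' (i + 1) * (X.h i + X.h (i + 1)) + X.h i) * e4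
  -- The end indices `0` and `m + 1`: both weights are zero, and `x_{i-1} = x_i` because the end
  -- knots are repeated.
  · rcases (by omega : i = 0 ∨ (X.m : ℤ) ≤ i - 1) with h1 | h1
    · rw [h1, X.x_of_nonpos (i := 0) le_rfl, X.x_of_nonpos (i := 0 - 1) (by omega)]; ring
    · rw [X.x_of_ge (i := i) (by omega), X.x_of_ge h1]; ring

end Partition

/-! ### The piecewise quadratic function on one square -/

/-- The jump coefficient of the second derivatives across the diagonal `u = v`. -/
def jumpMain (b : Fin 8 → ℝ) : ℝ := b 1 - b 2 - b 4 - b 7 + b 5 + b 6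

/-- The jump coefficient of the second derivatives across the diagonal `u + v = 1`. -/
def jumpAnti (b : Fin 8 → ℝ) : ℝ := b 3 - b 0 - b 5 - b 7 + b 4 + b 6

/-- The function `square` in truncated power form; `b` lists the corner coefficients
`b₀₀, b₁₀, b₀₁, b₁₁` and the edge coefficients `eS, eN, eW, eE`. -/
def spl (b : Fin 8 → ℝ) (u v : ℝ) : ℝ :=
  b 0 * (1 - u - v) ^ 2 + b 2 * (v - u) ^ 2 + (b 4 + b 5 + b 6 + b 7) * u ^ 2
    + 2 * b 6 * ((1 - u - v) * (v - u)) + 2 * (b 4 + b 6) * ((1 - u - v) * u)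
    + 2 * (b 5 + b 6) * ((v - u) * u)
    + jumpMain b * max 0 (u - v) ^ 2 + jumpAnti b * max 0 (u + v - 1) ^ 2

/-- The `u`-derivative of `spl b`, when `m` and `n` are the positive parts of `u - v` and
`u + v - 1`. -/
def splU (b : Fin 8 → ℝ) (u v m n : ℝ) : ℝ :=
  -2 * b 0 * (1 - u - v) - 2 * b 2 * (v - u) + 2 * (b 4 + b 5 + b 6 + b 7) * u
    + 2 * b 6 * (2 * u - 1) + 2 * (b 4 + b 6) * (1 - 2 * u - v)
    + 2 * (b 5 + b 6) * (v - 2 * u) + 2 * jumpMain b * m + 2 * jumpAnti b * n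

/-- The `v`-derivative of `spl b`, when `m` and `n` are the positive parts of `u - v` and
`u + v - 1`. -/
def splV (b : Fin 8 → ℝ) (u v m n : ℝ) : ℝ :=
  -2 * b 0 * (1 - u - v) + 2 * b 2 * (v - u) + 2 * b 6 * (1 - 2 * v) - 2 * (b 4 + b 6) * u
    + 2 * (b 5 + b 6) * u - 2 * jumpMain b * m + 2 * jumpAnti b * n

/-- The second `u`-derivative of `spl b` in the cell where the positive parts of `u - v` and
`u + v - 1` are `m * (u - v)` and `n * (u + v - 1)`. -/
def splUU (b : Fin 8 → ℝ) (m n : ℝ) : ℝ :=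
  2 * b 0 + 2 * b 2 + 2 * (b 4 + b 5 + b 6 + b 7) + 4 * b 6 - 4 * (b 4 + b 6) - 4 * (b 5 + b 6)
    + 2 * jumpMain b * m + 2 * jumpAnti b * n

/-- The mixed second derivative of `spl b` in the cell where the positive parts of `u - v` and
`u + v - 1` are `m * (u - v)` and `n * (u + v - 1)`. -/
def splUV (b : Fin 8 → ℝ) (m n : ℝ) : ℝ :=
  2 * b 0 - 2 * b 2 - 2 * (b 4 + b 6) + 2 * (b 5 + b 6) - 2 * jumpMain b * m + 2 * jumpAnti b * n

/-- The second `v`-derivative of `spl b` in the cell where the positive parts of `u - v` and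
`u + v - 1` are `m * (u - v)` and `n * (u + v - 1)`. -/
def splVV (b : Fin 8 → ℝ) (m n : ℝ) : ℝ :=
  2 * b 0 + 2 * b 2 - 4 * b 6 + 2 * jumpMain b * m + 2 * jumpAnti b * n

/-- The base polynomial of `spl` is the one on the left triangle. Crossing a diagonal with `C¹`
contact can only add a multiple of the square of the diagonal's linear form, so one formula covers
all four triangles. -/
theorem square_eq_spl (b₀ b₁ b₂ b₃ b₄ b₅ b₆ b₇ u v : ℝ) :
    square b₀ b₁ b₂ b₃ b₄ b₅ b₆ b₇ u v = spl ![b₀, b₁, b₂, b₃, b₄, b₅, b₆, b₇] u v := by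
  unfold square
  split_ifs with h1 h2 h2
  · rw [spl, max_eq_right (by linarith), max_eq_left (by linarith)]
    simp [bernstein, jumpMain, jumpAnti]
    ring
  · rw [spl, max_eq_right (by linarith), max_eq_right (by linarith)]
    simp [bernstein, jumpMain, jumpAnti]
    ring
  · rw [spl, max_eq_left (by linarith), max_eq_left (by linarith)]
    simp [bernstein, jumpMain, jumpAnti]
    ring
  · rw [spl, max_eq_left (by linarith), max_eq_right (by linarith)]
    simp [bernstein, jumpMain, jumpAnti]
    ring

theorem splU_add (b c : Fin 8 → ℝ) (u v m n : ℝ) :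
    splU (b + c) u v m n = splU b u v m n + splU c u v m n := by
  simp only [splU, jumpMain, jumpAnti, Pi.add_apply]; ring

theorem splV_add (b c : Fin 8 → ℝ) (u v m n : ℝ) :
    splV (b + c) u v m n = splV b u v m n + splV c u v m n := by
  simp only [splV, jumpMain, jumpAnti, Pi.add_apply]; ring

theorem splUU_add (b c : Fin 8 → ℝ) (m n : ℝ) :
    splUU (b + c) m n = splUU b m n + splUU c m n := by
  simp only [splUU, jumpMain, jumpAnti, Pi.add_apply]; ring

theorem splUV_add (b c : Fin 8 → ℝ) (m n : ℝ) :
    splUV (b + c) m n = splUV b m n + splUV c m n := by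
  simp only [splUV, jumpMain, jumpAnti, Pi.add_apply]; ring

theorem splVV_add (b c : Fin 8 → ℝ) (m n : ℝ) :
    splVV (b + c) m n = splVV b m n + splVV c m n := by
  simp only [splVV, jumpMain, jumpAnti, Pi.add_apply]; ring

section bounds

variable {b : Fin 8 → ℝ} {K : ℝ}

theorem abs_mul_le_of_le_one {x y K : ℝ} (hx : |x| ≤ K) (hy : |y| ≤ 1) : |x * y| ≤ K := by
  rw [abs_mul]
  exact (mul_le_of_le_one_right (abs_nonneg x) hy).trans hx

theorem abs_jumpMain_le (hb : ∀ i, |b i| ≤ K) : |jumpMain b| ≤ 6 * K := by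
  have h := fun i => abs_le.1 (hb i)
  rw [jumpMain, abs_le]
  constructor <;> linarith [h 1, h 2, h 4, h 7, h 5, h 6]

theorem abs_jumpAnti_le (hb : ∀ i, |b i| ≤ K) : |jumpAnti b| ≤ 6 * K := by
  have h := fun i => abs_le.1 (hb i)
  rw [jumpAnti, abs_le]
  constructor <;> linarith [h 3, h 0, h 5, h 7, h 4, h 6]

/-- Here and in the four lemmas below, 100 is a round number above every sum of absolute values of
the coefficients. -/
theorem abs_splUU_le (hb : ∀ i, |b i| ≤ K) {m n : ℝ} (hm : |m| ≤ 1) (hn : |n| ≤ 1) :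
    |splUU b m n| ≤ 100 * K := by
  have h := fun i => abs_le.1 (hb i)
  have h1 := abs_le.1 (abs_mul_le_of_le_one (abs_jumpMain_le hb) hm)
  have h2 := abs_le.1 (abs_mul_le_of_le_one (abs_jumpAnti_le hb) hn)
  rw [splUU, abs_le]
  constructor <;> linarith [h 0, h 2, h 4, h 5, h 6, h 7]

theorem abs_splUV_le (hb : ∀ i, |b i| ≤ K) {m n : ℝ} (hm : |m| ≤ 1) (hn : |n| ≤ 1) :
    |splUV b m n| ≤ 100 * K := by
  have h := fun i => abs_le.1 (hb i)
  have h1 := abs_le.1 (abs_mul_le_of_le_one (abs_jumpMain_le hb) hm)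
  have h2 := abs_le.1 (abs_mul_le_of_le_one (abs_jumpAnti_le hb) hn)
  rw [splUV, abs_le]
  constructor <;> linarith [h 0, h 2, h 4, h 5, h 6, h 7]

theorem abs_splVV_le (hb : ∀ i, |b i| ≤ K) {m n : ℝ} (hm : |m| ≤ 1) (hn : |n| ≤ 1) :
    |splVV b m n| ≤ 100 * K := by
  have h := fun i => abs_le.1 (hb i)
  have h1 := abs_le.1 (abs_mul_le_of_le_one (abs_jumpMain_le hb) hm)
  have h2 := abs_le.1 (abs_mul_le_of_le_one (abs_jumpAnti_le hb) hn)
  rw [splVV, abs_le]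
  constructor <;> linarith [h 0, h 2, h 4, h 5, h 6, h 7]

theorem abs_splU_le (hb : ∀ i, |b i| ≤ K) {u v m n : ℝ} (hu : u ∈ Set.Icc (0 : ℝ) 1)
    (hv : v ∈ Set.Icc (0 : ℝ) 1) (hm : |m| ≤ 1) (hn : |n| ≤ 1) : |splU b u v m n| ≤ 100 * K := by
  obtain ⟨hu0, hu1⟩ := hu
  obtain ⟨hv0, hv1⟩ := hv
  have h := fun i => abs_le.1 (hb i)
  have h1 := abs_le.1 (abs_mul_le_of_le_one (abs_jumpMain_le hb) hm)
  have h2 := abs_le.1 (abs_mul_le_of_le_one (abs_jumpAnti_le hb) hn)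
  have hu' : |u| ≤ 1 := abs_le.2 ⟨by linarith, by linarith⟩
  have hv' : |v| ≤ 1 := abs_le.2 ⟨by linarith, by linarith⟩
  have h3 := fun i => abs_le.1 (abs_mul_le_of_le_one (hb i) hu')
  have h4 := fun i => abs_le.1 (abs_mul_le_of_le_one (hb i) hv')
  rw [splU, abs_le]
  constructor <;> linarith [h 0, h 2, h 4, h 5, h 6, h 7, h3 0, h3 2, h3 4, h3 5, h3 6, h3 7,
    h4 0, h4 2, h4 4, h4 5, h4 6, h4 7]

theorem abs_splV_le (hb : ∀ i, |b i| ≤ K) {u v m n : ℝ} (hu : u ∈ Set.Icc (0 : ℝ) 1)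
    (hv : v ∈ Set.Icc (0 : ℝ) 1) (hm : |m| ≤ 1) (hn : |n| ≤ 1) : |splV b u v m n| ≤ 100 * K := by
  obtain ⟨hu0, hu1⟩ := hu
  obtain ⟨hv0, hv1⟩ := hv
  have h := fun i => abs_le.1 (hb i)
  have h1 := abs_le.1 (abs_mul_le_of_le_one (abs_jumpMain_le hb) hm)
  have h2 := abs_le.1 (abs_mul_le_of_le_one (abs_jumpAnti_le hb) hn)
  have hu' : |u| ≤ 1 := abs_le.2 ⟨by linarith, by linarith⟩
  have hv' : |v| ≤ 1 := abs_le.2 ⟨by linarith, by linarith⟩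
  have h3 := fun i => abs_le.1 (abs_mul_le_of_le_one (hb i) hu')
  have h4 := fun i => abs_le.1 (abs_mul_le_of_le_one (hb i) hv')
  rw [splV, abs_le]
  constructor <;> linarith [h 0, h 2, h 4, h 5, h 6, h 7, h3 0, h3 2, h3 4, h3 5, h3 6, h3 7,
    h4 0, h4 2, h4 4, h4 5, h4 6, h4 7]

end bounds

/-- At `0` the function is `O(t ^ 2)`, so its derivative vanishes there. This makes `spl`
differentiable on the whole plane with no case distinction at the diagonals. -/
theorem hasDerivAt_max_zero_sq (t : ℝ) :
    HasDerivAt (fun t : ℝ => max 0 t ^ 2) (2 * max 0 t) t := by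
  rcases lt_trichotomy t 0 with h | rfl | h
  · rw [max_eq_left h.le, mul_zero]
    refine (hasDerivAt_const t (0 : ℝ)).congr_of_eventuallyEq ?_
    filter_upwards [Iio_mem_nhds h] with s hs
    rw [max_eq_left (le_of_lt hs)]; norm_num
  · rw [hasDerivAt_iff_isLittleO]
    simp only [max_self, sub_zero, mul_zero, smul_zero, ne_eq, OfNat.ofNat_ne_zero,
      not_false_eq_true, zero_pow]
    refine Asymptotics.IsBigO.trans_isLittleO (g := fun t : ℝ => t ^ 2) ?_ ?_
    · refine Asymptotics.isBigO_of_le _ fun s => ?_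
      rw [Real.norm_eq_abs, Real.norm_eq_abs, abs_of_nonneg (by positivity),
        abs_of_nonneg (by positivity)]
      rcases le_total s 0 with h | h
      · rw [max_eq_left h]; nlinarith
      · rw [max_eq_right h]
    · simpa using (Asymptotics.isLittleO_pow_pow (𝕜 := ℝ) (m := 1) (n := 2) (by norm_num))
  · rw [max_eq_right h.le]
    have h1 : HasDerivAt (fun t : ℝ => t ^ 2) (2 * t) t := by simpa using hasDerivAt_pow 2 t
    refine h1.congr_of_eventuallyEq ?_
    filter_upwards [Ioi_mem_nhds h] with s hs
    rw [max_eq_right (le_of_lt hs)]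

/-- The continuous linear functional `q ↦ e * q.1 + g * q.2`. -/
noncomputable def grad (e g : ℝ) : ℝ × ℝ →L[ℝ] ℝ :=
  e • ContinuousLinearMap.fst ℝ ℝ ℝ + g • ContinuousLinearMap.snd ℝ ℝ ℝ

theorem grad_apply (e g : ℝ) (q : ℝ × ℝ) : grad e g q = e * q.1 + g * q.2 := by
  simp [grad]

theorem hasFDerivAt_spl (b : Fin 8 → ℝ) (q : ℝ × ℝ) :
    HasFDerivAt (fun q : ℝ × ℝ => spl b q.1 q.2)
      (grad (splU b q.1 q.2 (max 0 (q.1 - q.2)) (max 0 (q.1 + q.2 - 1)))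
        (splV b q.1 q.2 (max 0 (q.1 - q.2)) (max 0 (q.1 + q.2 - 1)))) q := by
  have hu : HasFDerivAt (fun q : ℝ × ℝ => q.1) (ContinuousLinearMap.fst ℝ ℝ ℝ) q := hasFDerivAt_fst
  have hv : HasFDerivAt (fun q : ℝ × ℝ => q.2) (ContinuousLinearMap.snd ℝ ℝ ℝ) q := hasFDerivAt_snd
  have hd := hv.sub hu
  have ha := (hu.const_sub 1).sub hv
  have hA := (hasDerivAt_max_zero_sq (q.1 - q.2)).comp_hasFDerivAt q (hu.sub hv)
  have hB := (hasDerivAt_max_zero_sq (q.1 + q.2 - 1)).comp_hasFDerivAt q ((hu.add hv).sub_const 1)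
  have := (((((((ha.pow 2).const_mul (b 0)).add ((hd.pow 2).const_mul (b 2))).add
    ((hu.pow 2).const_mul (b 4 + b 5 + b 6 + b 7))).add ((ha.mul hd).const_mul (2 * b 6))).add
    ((ha.mul hu).const_mul (2 * (b 4 + b 6)))).add ((hd.mul hu).const_mul (2 * (b 5 + b 6)))).add
    (hA.const_mul (jumpMain b)) |>.add (hB.const_mul (jumpAnti b))
  refine this.congr_fderiv ?_
  ext <;> simp [grad, splU, splV] <;> ring

theorem hasFDerivAt_affine (x y h k : ℝ) (p : ℝ × ℝ) :
    HasFDerivAt (fun p : ℝ × ℝ => ((p.1 - x) / h, (p.2 - y) / k))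
      (ContinuousLinearMap.prod (grad h⁻¹ 0) (grad 0 k⁻¹)) p := by
  have hu : HasFDerivAt (fun q : ℝ × ℝ => q.1) (ContinuousLinearMap.fst ℝ ℝ ℝ) p := hasFDerivAt_fst
  have hv : HasFDerivAt (fun q : ℝ × ℝ => q.2) (ContinuousLinearMap.snd ℝ ℝ ℝ) p := hasFDerivAt_snd
  have := ((hu.sub_const x).mul_const h⁻¹).prodMk ((hv.sub_const y).mul_const k⁻¹)
  simp only [div_eq_mul_inv]
  refine this.congr_fderiv ?_
  ext <;> simp [grad]

/-- On the common edge the normal derivative is affine in `v`, so it is enough that it matches at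
the two corners. There it is `2 (b 1 - b 4) / h` against `2 (b' 4 - b 1) / h'`, and the lever law
makes these equal; likewise at the other corner. The tangential derivative only sees the three
shared coefficients. -/
theorem spl_glue_left {b b' : Fin 8 → ℝ} {h h' e e' v : ℝ} (hh : 0 < h) (hh' : 0 < h')
    (he : e + e' = 1) (heh : e * h = e' * h')
    (h0 : b' 0 = b 1) (h2 : b' 2 = b 3) (h6 : b' 6 = b 7)
    (h1 : b 1 = e * b 4 + e' * b' 4) (h3 : b 3 = e * b 5 + e' * b' 5) :
    splU b 1 v (1 - v) v / h = splU b' 0 v 0 0 / h' ∧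
      splV b 1 v (1 - v) v = splV b' 0 v 0 0 := by
  have hs : e' = h / (h + h') := by
    field_simp; linear_combination h * he - heh
  have hs' : e = h' / (h + h') := by
    field_simp; linear_combination h' * he + heh
  constructor
  · simp only [splU, jumpMain, jumpAnti, h0, h2, h6]
    rw [h1, h3, hs, hs']
    field_simp
    ring
  · simp only [splV, jumpMain, jumpAnti, h0, h2, h6]
    ring

theorem spl_glue_below {b b' : Fin 8 → ℝ} {h h' e e' u : ℝ} (hh : 0 < h) (hh' : 0 < h')
    (he : e + e' = 1) (heh : e * h = e' * h')
    (h0 : b' 0 = b 2) (h1 : b' 1 = b 3) (h4 : b' 4 = b 5)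
    (h2 : b 2 = e * b 6 + e' * b' 6) (h3 : b 3 = e * b 7 + e' * b' 7) :
    splV b u 1 0 u / h = splV b' u 0 u 0 / h' ∧
      splU b u 1 0 u = splU b' u 0 u 0 := by
  have hs : e' = h / (h + h') := by
    field_simp; linear_combination h * he - heh
  have hs' : e = h' / (h + h') := by
    field_simp; linear_combination h' * he + heh
  constructor
  · simp only [splV, jumpMain, jumpAnti, h0, h1, h4]
    rw [h2, h3, hs, hs']
    field_simp
    ring
  · simp only [splU, jumpMain, jumpAnti, h0, h1, h4]
    ring

/-! ### Gluing the pieces into a `C¹` spline on the rectangle -/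

namespace Partition

variable {a b : ℝ} (X : Partition a b)

/-- The affine coordinate on `[x_{r-1}, x_r]`. -/
noncomputable def coord (r : ℤ) (t : ℝ) : ℝ := (t - X.x (r - 1)) / X.h r

theorem coord_mem {r : ℤ} (h1 : 1 ≤ r) (h2 : r ≤ X.m) {t : ℝ}
    (ht : t ∈ Set.Icc (X.x (r - 1)) (X.x r)) : X.coord r t ∈ Set.Icc (0 : ℝ) 1 := by
  have := X.h_pos h1 h2
  refine ⟨div_nonneg (sub_nonneg.2 ht.1) this.le, (div_le_one this).2 ?_⟩
  rw [h]; linarith [ht.2]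

theorem coord_right {r : ℤ} (h1 : 1 ≤ r) (h2 : r ≤ X.m) : X.coord r (X.x r) = 1 :=
  div_self (X.h_pos h1 h2).ne'

theorem coord_left (r : ℤ) : X.coord (r + 1) (X.x r) = 0 := by
  simp [coord]

end Partition

namespace Grid

variable {a b c d : ℝ} (P : Grid a b c d)

/-- The closed subrectangle `[x_{r-1}, x_r] × [y_{s-1}, y_s]`. -/
def box (r s : ℤ) : Set (ℝ × ℝ) :=
  Set.Icc (P.X.x (r - 1)) (P.X.x r) ×ˢ Set.Icc (P.Y.x (s - 1)) (P.Y.x s)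

/-- `r` and `s` number a subrectangle. -/
def IsBox (r s : ℤ) : Prop := (1 ≤ r ∧ r ≤ P.X.m) ∧ (1 ≤ s ∧ s ≤ P.Y.m)

/-- The Bernstein-Bézier coefficients on the subrectangle `box r s` of the spline `∑ φ_{ij} B_{ij}`. -/
noncomputable def net (φ : ℤ → ℤ → ℝ) (r s : ℤ) : Fin 8 → ℝ :=
  ![P.X.val (r - 1) fun i => P.Y.val (s - 1) (φ i), P.X.val r fun i => P.Y.val (s - 1) (φ i),
    P.X.val (r - 1) fun i => P.Y.val s (φ i), P.X.val r fun i => P.Y.val s (φ i),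
    P.Y.val (s - 1) (φ r), P.Y.val s (φ r),
    P.X.val (r - 1) fun i => φ i s, P.X.val r fun i => φ i s]

/-- The affine coordinates on `box r s`. -/
noncomputable def coord (r s : ℤ) (p : ℝ × ℝ) : ℝ × ℝ := (P.X.coord r p.1, P.Y.coord s p.2)

/-- The restriction to `box r s` of the spline `∑ φ_{ij} B_{ij}`. -/
noncomputable def piece (φ : ℤ → ℤ → ℝ) (r s : ℤ) (p : ℝ × ℝ) : ℝ :=
  spl (P.net φ r s) (P.coord r s p).1 (P.coord r s p).2

/-- The `x`-derivative of `piece`. -/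
noncomputable def pieceX (φ : ℤ → ℤ → ℝ) (r s : ℤ) (p : ℝ × ℝ) : ℝ :=
  splU (P.net φ r s) (P.coord r s p).1 (P.coord r s p).2
    (max 0 ((P.coord r s p).1 - (P.coord r s p).2))
    (max 0 ((P.coord r s p).1 + (P.coord r s p).2 - 1)) / P.X.h r

/-- The `y`-derivative of `piece`. -/
noncomputable def pieceY (φ : ℤ → ℤ → ℝ) (r s : ℤ) (p : ℝ × ℝ) : ℝ :=
  splV (P.net φ r s) (P.coord r s p).1 (P.coord r s p).2
    (max 0 ((P.coord r s p).1 - (P.coord r s p).2))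
    (max 0 ((P.coord r s p).1 + (P.coord r s p).2 - 1)) / P.Y.h s

/-- The value and the partial derivatives of `piece`. -/
noncomputable def jet (φ : ℤ → ℤ → ℝ) (r s : ℤ) (p : ℝ × ℝ) : ℝ × ℝ × ℝ :=
  (P.piece φ r s p, P.pieceX φ r s p, P.pieceY φ r s p)

variable (φ : ℤ → ℤ → ℝ)

theorem jet_glue_left (hab : a < b) {r s : ℤ} (h1 : 1 ≤ r) (h2 : r < P.X.m) (h3 : 1 ≤ s)
    (h4 : s ≤ P.Y.m) {p : ℝ × ℝ} (hx : p.1 = P.X.x r)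
    (hp : p.2 ∈ Set.Icc (P.Y.x (s - 1)) (P.Y.x s)) :
    P.jet φ (r + 1) s p = P.jet φ r s p := by
  have e1 : (P.coord r s p).1 = 1 := by rw [coord, hx, P.X.coord_right h1 h2.le]
  have e2 : (P.coord (r + 1) s p).1 = 0 := by rw [coord, hx, P.X.coord_left]
  obtain ⟨hv0, hv1⟩ := P.Y.coord_mem h3 h4 hp
  have e3 : (P.coord r s p).2 = P.Y.coord s p.2 := rfl
  have e4 : (P.coord (r + 1) s p).2 = P.Y.coord s p.2 := rfl
  obtain ⟨g1, g2⟩ := spl_glue_left (b := P.net φ r s) (b' := P.net φ (r + 1) s)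
    (v := P.Y.coord s p.2) (P.X.h_pos h1 h2.le) (P.X.h_pos (i := r + 1) (by omega) (by omega))
    (P.X.σ_add_σ' hab (by omega) h2.le) (P.X.σ_mul_h hab (by omega) h2.le)
    (by simp [net]) (by simp [net]) (by simp [net])
    (by simp [net, Partition.val]) (by simp [net, Partition.val])
  simp only [jet, piece, pieceX, pieceY, e1, e2, e3, e4]
  -- On the edge `u = 0` both positive parts vanish; on `u = 1` they are `1 - v` and `v`.
  rw [max_eq_left (by linarith : 0 - P.Y.coord s p.2 ≤ 0),
    max_eq_left (by linarith : 0 + P.Y.coord s p.2 - 1 ≤ 0),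
    max_eq_right (by linarith : 0 ≤ 1 - P.Y.coord s p.2),
    max_eq_right (by linarith : 0 ≤ 1 + P.Y.coord s p.2 - 1),
    show 1 + P.Y.coord s p.2 - 1 = P.Y.coord s p.2 by ring, g1, g2]
  congr 1
  simp only [spl]
  rw [max_eq_left (by linarith : 0 - P.Y.coord s p.2 ≤ 0),
    max_eq_left (by linarith : 0 + P.Y.coord s p.2 - 1 ≤ 0),
    max_eq_right (by linarith : 0 ≤ 1 - P.Y.coord s p.2),
    max_eq_right (by linarith : 0 ≤ 1 + P.Y.coord s p.2 - 1)]
  simp [net, jumpMain, jumpAnti]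
  ring

theorem jet_glue_below (hcd : c < d) {r s : ℤ} (h1 : 1 ≤ s) (h2 : s < P.Y.m) (h3 : 1 ≤ r)
    (h4 : r ≤ P.X.m) {p : ℝ × ℝ} (hy : p.2 = P.Y.x s)
    (hp : p.1 ∈ Set.Icc (P.X.x (r - 1)) (P.X.x r)) :
    P.jet φ r (s + 1) p = P.jet φ r s p := by
  have e1 : (P.coord r s p).2 = 1 := by rw [coord, hy, P.Y.coord_right h1 h2.le]
  have e2 : (P.coord r (s + 1) p).2 = 0 := by rw [coord, hy, P.Y.coord_left]
  obtain ⟨hv0, hv1⟩ := P.X.coord_mem h3 h4 hp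
  have e3 : (P.coord r s p).1 = P.X.coord r p.1 := rfl
  have e4 : (P.coord r (s + 1) p).1 = P.X.coord r p.1 := rfl
  obtain ⟨g1, g2⟩ := spl_glue_below (b := P.net φ r s) (b' := P.net φ r (s + 1))
    (u := P.X.coord r p.1) (P.Y.h_pos h1 h2.le) (P.Y.h_pos (i := s + 1) (by omega) (by omega))
    (P.Y.σ_add_σ' hcd (by omega) h2.le) (P.Y.σ_mul_h hcd (by omega) h2.le)
    (by simp [net]) (by simp [net]) (by simp [net])
    (by simp [net, Partition.val]; ring) (by simp [net, Partition.val]; ring)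
  simp only [jet, piece, pieceX, pieceY, e1, e2, e3, e4]
  rw [max_eq_right (by linarith : 0 ≤ P.X.coord r p.1 - 0),
    max_eq_left (by linarith : P.X.coord r p.1 + 0 - 1 ≤ 0),
    max_eq_left (by linarith : P.X.coord r p.1 - 1 ≤ 0),
    max_eq_right (by linarith : 0 ≤ P.X.coord r p.1 + 1 - 1),
    show P.X.coord r p.1 + 1 - 1 = P.X.coord r p.1 by ring, sub_zero, g1, g2]
  congr 1
  simp only [spl]
  rw [max_eq_right (by linarith : 0 ≤ P.X.coord r p.1 - 0),
    max_eq_left (by linarith : P.X.coord r p.1 + 0 - 1 ≤ 0),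
    max_eq_left (by linarith : P.X.coord r p.1 - 1 ≤ 0),
    max_eq_right (by linarith : 0 ≤ P.X.coord r p.1 + 1 - 1)]
  simp [net, jumpMain, jumpAnti]
  ring

/-- The value and the partial derivatives of the spline `∑ φ_{ij} B_{ij}`. -/
noncomputable def splineJet (p : ℝ × ℝ) : ℝ × ℝ × ℝ := P.jet φ (P.X.cell p.1) (P.Y.cell p.2) p

/-- Value and gradient may be computed in any closed box that contains the point, not only in the
one that `cell` selects. -/
theorem splineJet_eq (hab : a < b) (hcd : c < d) {r s : ℤ} (hrs : P.IsBox r s) {p : ℝ × ℝ}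
    (hp : p ∈ P.box r s) : P.splineJet φ p = P.jet φ r s p := by
  obtain ⟨⟨h1, h2⟩, h3, h4⟩ := hrs
  obtain ⟨hx, hy⟩ := hp
  unfold splineJet
  rcases P.Y.cell_eq_or h3 h4 hy with e | ⟨e1, e2, e3⟩ <;>
  rcases P.X.cell_eq_or h1 h2 hx with g | ⟨g1, g2, g3⟩
  · rw [e, g]
  · rw [e, g2, P.jet_glue_left φ hab h1 g3 h3 h4 g1 hy]
  · rw [e2, g, P.jet_glue_below φ hcd h3 e3 h1 h2 e1 hx]
  -- The upper right corner: pass from box `(r + 1, s + 1)` to `(r, s + 1)` and then to `(r, s)`.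
  -- The remaining goal is that the corner lies on the left edge of box `(r, s + 1)`.
  · rw [e2, g2, P.jet_glue_left φ hab h1 g3 (by omega) (by omega) g1,
      P.jet_glue_below φ hcd h3 e3 h1 h2 e1 hx]
    rw [show s + 1 - 1 = s by ring, ← e1]
    refine ⟨le_rfl, ?_⟩
    rw [e1]
    exact P.Y.x_mono (by omega)

theorem hasFDerivAt_piece (r s : ℤ) (p : ℝ × ℝ) :
    HasFDerivAt (P.piece φ r s) (grad (P.pieceX φ r s p) (P.pieceY φ r s p)) p := by
  have := (hasFDerivAt_spl (P.net φ r s) (P.coord r s p)).comp p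
    (hasFDerivAt_affine (P.X.x (r - 1)) (P.Y.x (s - 1)) (P.X.h r) (P.Y.h s) p)
  refine this.congr_fderiv ?_
  ext <;> simp [grad, pieceX, pieceY, div_eq_mul_inv]

theorem continuous_jet (r s : ℤ) : Continuous (P.jet φ r s) := by
  have h1 : Continuous fun p => (P.coord r s p).1 := by
    unfold coord Partition.coord
    fun_prop
  have h2 : Continuous fun p => (P.coord r s p).2 := by
    unfold coord Partition.coord
    fun_prop
  unfold jet piece pieceX pieceY spl splU splV
  obtain ⟨u, hu⟩ : ∃ u : ℝ × ℝ → ℝ, u = fun p => (P.coord r s p).1 := ⟨_, rfl⟩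
  obtain ⟨v, hv⟩ : ∃ v : ℝ × ℝ → ℝ, v = fun p => (P.coord r s p).2 := ⟨_, rfl⟩
  simp only [← congrFun hu, ← congrFun hv]
  rw [← hu] at h1
  rw [← hv] at h2
  fun_prop

theorem isClosed_box (r s : ℤ) : IsClosed (P.box r s) := isClosed_Icc.prod isClosed_Icc

/-- The numbers of all subrectangles. -/
noncomputable def boxes : Finset (ℤ × ℤ) := Finset.Icc (1 : ℤ) P.X.m ×ˢ Finset.Icc (1 : ℤ) P.Y.m

theorem mem_boxes {q : ℤ × ℤ} : q ∈ P.boxes ↔ P.IsBox q.1 q.2 := by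
  simp [boxes, IsBox]

theorem isBox_cell (hab : a < b) (hcd : c < d) {p : ℝ × ℝ} (hp : p ∈ rect a b c d) :
    P.IsBox (P.X.cell p.1) (P.Y.cell p.2) :=
  ⟨(P.X.cell_spec hab hp.1).1, (P.Y.cell_spec hcd hp.2).1⟩

theorem mem_box_cell (hab : a < b) (hcd : c < d) {p : ℝ × ℝ} (hp : p ∈ rect a b c d) :
    p ∈ P.box (P.X.cell p.1) (P.Y.cell p.2) :=
  ⟨(P.X.cell_spec hab hp.1).2, (P.Y.cell_spec hcd hp.2).2⟩

theorem box_subset_rect (r s : ℤ) : P.box r s ⊆ rect a b c d := fun _ hp =>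
  ⟨⟨(P.X.x_mem _).1.trans hp.1.1, hp.1.2.trans (P.X.x_mem _).2⟩,
    ⟨(P.Y.x_mem _).1.trans hp.2.1, hp.2.2.trans (P.Y.x_mem _).2⟩⟩

theorem rect_eq_iUnion (hab : a < b) (hcd : c < d) :
    rect a b c d = ⋃ q : P.boxes, P.box q.1.1 q.1.2 := by
  refine Set.Subset.antisymm (fun p hp => ?_) (Set.iUnion_subset fun q => P.box_subset_rect _ _)
  exact Set.mem_iUnion.2 ⟨⟨(P.X.cell p.1, P.Y.cell p.2), P.mem_boxes.2 (P.isBox_cell hab hcd hp)⟩,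
    P.mem_box_cell hab hcd hp⟩

theorem continuousOn_splineJet (hab : a < b) (hcd : c < d) :
    ContinuousOn (P.splineJet φ) (rect a b c d) := by
  rw [P.rect_eq_iUnion hab hcd]
  refine (locallyFinite_of_finite _).continuousOn_iUnion (fun q => P.isClosed_box _ _) fun q => ?_
  exact (P.continuous_jet φ q.1.1 q.1.2).continuousOn.congr fun p hp =>
    P.splineJet_eq φ hab hcd (P.mem_boxes.1 q.2) hp

/-- The boxes are a finite closed cover. In a box containing `p` the spline is a differentiable
piece whose gradient does not depend on the box; for a box missing `p` there is nothing to check.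
Derivatives within finitely many sets then pass to the union. -/
theorem hasFDerivWithinAt_splineJet (hab : a < b) (hcd : c < d) {p : ℝ × ℝ} :
    HasFDerivWithinAt (fun p => (P.splineJet φ p).1)
      (grad (P.splineJet φ p).2.1 (P.splineJet φ p).2.2) (rect a b c d) p := by
  have key : ∀ t : Finset (ℤ × ℤ), t ⊆ P.boxes →
      HasFDerivWithinAt (fun p => (P.splineJet φ p).1)
        (grad (P.splineJet φ p).2.1 (P.splineJet φ p).2.2) (⋃ q ∈ t, P.box q.1 q.2) p := by
    intro t
    induction t using Finset.induction_on with
    | empty => simp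
    | insert q t _ ih =>
      intro ht
      rw [Finset.set_biUnion_insert]
      refine HasFDerivWithinAt.union ?_ (ih ((Finset.subset_insert q t).trans ht))
      have hq := P.mem_boxes.1 (ht (Finset.mem_insert_self q t))
      by_cases hp : p ∈ P.box q.1 q.2
      · rw [P.splineJet_eq φ hab hcd hq hp]
        refine (P.hasFDerivAt_piece φ q.1 q.2 p).hasFDerivWithinAt.congr (fun z hz => ?_) ?_
        · rw [P.splineJet_eq φ hab hcd hq hz]; rfl
        · rw [P.splineJet_eq φ hab hcd hq hp]; rfl
      · refine HasFDerivWithinAt.of_notMem_closure ?_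
        rwa [(P.isClosed_box _ _).closure_eq]
  have := key P.boxes subset_rfl
  rwa [P.rect_eq_iUnion hab hcd, Set.iUnion_subtype]

end Grid

theorem uniqueDiffOn_rect {a b c d : ℝ} (hab : a < b) (hcd : c < d) :
    UniqueDiffOn ℝ (rect a b c d) :=
  (uniqueDiffOn_Icc hab).prod (uniqueDiffOn_Icc hcd)

theorem continuous_grad : Continuous fun z : ℝ × ℝ => grad z.1 z.2 := by
  unfold grad; fun_prop

theorem Grid.contDiffOn_splineJet {a b c d : ℝ} (P : Grid a b c d) (φ : ℤ → ℤ → ℝ) (hab : a < b)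
    (hcd : c < d) : ContDiffOn ℝ 1 (fun p => (P.splineJet φ p).1) (rect a b c d) := by
  rw [show (1 : WithTop ℕ∞) = 0 + 1 by simp,
    contDiffOn_succ_iff_fderivWithin (uniqueDiffOn_rect hab hcd)]
  refine ⟨fun p _ => (P.hasFDerivWithinAt_splineJet φ hab hcd).differentiableWithinAt,
    by simp, ?_⟩
  rw [contDiffOn_zero]
  refine (continuous_grad.comp_continuousOn
    (P.continuousOn_splineJet φ hab hcd).snd).congr fun p hp => ?_
  exact (P.hasFDerivWithinAt_splineJet φ hab hcd).fderivWithin (uniqueDiffOn_rect hab hcd p hp)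

/-- Every net coefficient of `B i j` is a factor in `i` times a factor in `j`, so by linearity of
`spl` the double sum collapses, one index at a time, to the local weights. -/
theorem Kind.apply_eq {a b c d : ℝ} (Q : Kind) (P : Grid a b c d) (hab : a < b) (hcd : c < d)
    (f : ℝ × ℝ → ℝ) {p : ℝ × ℝ} (hp : p ∈ rect a b c d) :
    Q.apply P f p = (P.splineJet (fun i j => Q.coeff P i j f) p).1 := by
  obtain ⟨⟨h1, h2⟩, h3, h4⟩ := P.isBox_cell hab hcd hp
  set r := P.X.cell p.1 with hr
  set s := P.Y.cell p.2 with hs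
  set φ : ℤ → ℤ → ℝ := fun i j => Q.coeff P i j f with hφ
  set u := (p.1 - P.X.x (r - 1)) / P.X.h r with hu
  set v := (p.2 - P.Y.x (s - 1)) / P.Y.h s with hv
  have hB : ∀ i j, P.B i j p = spl ![P.X.vtx i (r - 1) * P.Y.vtx j (s - 1),
      P.X.vtx i r * P.Y.vtx j (s - 1), P.X.vtx i (r - 1) * P.Y.vtx j s, P.X.vtx i r * P.Y.vtx j s,
      P.X.mid i r * P.Y.vtx j (s - 1), P.X.mid i r * P.Y.vtx j s,
      P.X.vtx i (r - 1) * P.Y.mid j s, P.X.vtx i r * P.Y.mid j s] u v := fun i j =>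
    square_eq_spl _ _ _ _ _ _ _ _ _ _
  -- Expansion in the eight unit nets, which reduces the identity to one equation for each
  -- coefficient.
  have hlin : ∀ b : Fin 8 → ℝ, spl b u v = ∑ e : Fin 8, b e * spl (Pi.single e 1) u v := by
    intro b
    simp [Fin.sum_univ_eight, spl, jumpMain, jumpAnti, Pi.single_apply]
    ring
  change _ = spl (P.net φ r s) u v
  unfold Kind.apply
  simp only [hB]
  rw [hlin (P.net φ r s)]
  simp_rw [hlin ![_, _, _, _, _, _, _, _], Finset.mul_sum, ← mul_assoc]
  rw [Finset.sum_congr rfl fun i _ => Finset.sum_comm, Finset.sum_comm]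
  refine Finset.sum_congr rfl fun e _ => ?_
  simp_rw [← Finset.sum_mul]
  congr 1
  have v1 := P.X.sum_vtx (r := r) (by omega) h2
  have v0 := P.X.sum_vtx (r := r - 1) (by omega) (by omega)
  have vm := P.X.sum_mid (r := r) (by omega) (by omega)
  have w1 := P.Y.sum_vtx (r := s) (by omega) h4
  have w0 := P.Y.sum_vtx (r := s - 1) (by omega) (by omega)
  have wm := P.Y.sum_mid (r := s) (by omega) (by omega)
  have key : ∀ α β : ℤ → ℝ, (∑ i ∈ Finset.Icc (0 : ℤ) (P.X.m + 1),
      ∑ j ∈ Finset.Icc (0 : ℤ) (P.Y.m + 1), Q.coeff P i j f * (α i * β j))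
      = ∑ i ∈ Finset.Icc (0 : ℤ) (P.X.m + 1),
        (∑ j ∈ Finset.Icc (0 : ℤ) (P.Y.m + 1), φ i j * β j) * α i := by
    intro α β
    refine Finset.sum_congr rfl fun i _ => ?_
    rw [Finset.sum_mul, hφ]
    exact Finset.sum_congr rfl fun j _ => by ring
  fin_cases e <;> simp [Grid.net, key, v1, v0, vm, w1, w0, wm]

/-! ### The modulus of continuity -/

section modulus

variable {a b c d : ℝ} {ψ : ℝ × ℝ → ℝ}

theorem isCompact_rect (a b c d : ℝ) : IsCompact (rect a b c d) := isCompact_Icc.prod isCompact_Icc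

theorem convex_rect (a b c d : ℝ) : Convex ℝ (rect a b c d) :=
  (convex_Icc a b).prod (convex_Icc c d)

theorem modulus_nonneg (Ω : Set (ℝ × ℝ)) (ψ : ℝ × ℝ → ℝ) (t : ℝ) : 0 ≤ modulus Ω ψ t := by
  refine Real.sSup_nonneg ?_
  rintro e ⟨p, _, q, _, _, rfl⟩
  exact abs_nonneg _

theorem le_modulus (hψ : ContinuousOn ψ (rect a b c d)) {p q : ℝ × ℝ} (hp : p ∈ rect a b c d)
    (hq : q ∈ rect a b c d) {t : ℝ} (h : √((p.1 - q.1) ^ 2 + (p.2 - q.2) ^ 2) ≤ t) :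
    |ψ p - ψ q| ≤ modulus (rect a b c d) ψ t := by
  obtain ⟨K, hK⟩ := (isCompact_rect a b c d).exists_bound_of_continuousOn hψ
  refine le_csSup ⟨K + K, ?_⟩ ⟨p, hp, q, hq, h, rfl⟩
  rintro e ⟨p, hp, q, hq, -, rfl⟩
  exact (abs_sub _ _).trans (add_le_add (hK p hp) (hK q hq))

theorem sqrt_sq_add_sq_le (x y : ℝ) : √(x ^ 2 + y ^ 2) ≤ |x| + |y| := by
  rw [Real.sqrt_le_left (by positivity), ← sq_abs x, ← sq_abs y]
  nlinarith [abs_nonneg x, abs_nonneg y, mul_nonneg (abs_nonneg x) (abs_nonneg y)]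

/-- Cut the segment from `p` to `q`, which stays in the convex rectangle, into `N` equal steps. This
is how `ω` at `H / 2` controls `ψ` over several steplengths. -/
theorem abs_sub_le_mul_modulus (hψ : ContinuousOn ψ (rect a b c d)) {p q : ℝ × ℝ}
    (hp : p ∈ rect a b c d) (hq : q ∈ rect a b c d) {t : ℝ} {N : ℕ} (hN : 0 < N)
    (h : |p.1 - q.1| + |p.2 - q.2| ≤ N * t) :
    |ψ p - ψ q| ≤ N * modulus (rect a b c d) ψ t := by
  have hN' : (0 : ℝ) < N := by exact_mod_cast hN
  set z : ℕ → ℝ × ℝ := fun k => p + ((k : ℝ) / N) • (q - p) with hz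
  have hmem : ∀ k ≤ N, z k ∈ rect a b c d := fun k hk =>
    (convex_rect a b c d).add_smul_sub_mem hp hq
      ⟨by positivity, (div_le_one hN').2 (by exact_mod_cast hk)⟩
  have hstep : ∀ k < N, |ψ (z k) - ψ (z (k + 1))| ≤ modulus (rect a b c d) ψ t := by
    intro k hk
    refine le_modulus hψ (hmem k hk.le) (hmem (k + 1) hk) ((sqrt_sq_add_sq_le _ _).trans ?_)
    have e1 : (z k).1 - (z (k + 1)).1 = (p.1 - q.1) / N := by
      simp only [hz, Prod.fst_add, Prod.smul_fst, Prod.fst_sub, smul_eq_mul]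
      push_cast; field_simp; ring
    have e2 : (z k).2 - (z (k + 1)).2 = (p.2 - q.2) / N := by
      simp only [hz, Prod.snd_add, Prod.smul_snd, Prod.snd_sub, smul_eq_mul]
      push_cast; field_simp; ring
    rw [e1, e2, abs_div, abs_div, abs_of_pos hN', ← add_div, div_le_iff₀ hN']
    linarith
  have hind : ∀ k ≤ N, |ψ (z 0) - ψ (z k)| ≤ k * modulus (rect a b c d) ψ t := by
    intro k
    induction k with
    | zero => simp
    | succ k ih =>
      intro hk
      have h1 := ih (by omega)
      have h2 := hstep k (by omega)
      have h3 := abs_sub_le (ψ (z 0)) (ψ (z k)) (ψ (z (k + 1)))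
      push_cast
      linarith
  have := hind N le_rfl
  have z0 : z 0 = p := by simp [hz]
  have zN : z N = q := by simp [hz, hN'.ne']
  rwa [z0, zN] at this

theorem exists_modulus_le (hψ : ContinuousOn ψ (rect a b c d)) {ε : ℝ} (hε : 0 < ε) :
    ∃ τ > 0, ∀ t < τ, modulus (rect a b c d) ψ t ≤ ε := by
  obtain ⟨τ, hτ, h⟩ := Metric.uniformContinuousOn_iff.1
    ((isCompact_rect a b c d).uniformContinuousOn_of_continuous hψ) ε hε
  refine ⟨τ, hτ, fun t ht => Real.sSup_le ?_ hε.le⟩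
  rintro e ⟨p, hp, q, hq, hpq, rfl⟩
  refine (h p hp q hq ?_).le
  -- The distance on `ℝ × ℝ` is the maximum of the coordinate distances, and each is at most the
  -- Euclidean one.
  have h1 := Real.abs_le_sqrt (x := p.1 - q.1) (y := (p.1 - q.1) ^ 2 + (p.2 - q.2) ^ 2)
    (by nlinarith [sq_nonneg (p.2 - q.2)])
  have h2 := Real.abs_le_sqrt (x := p.2 - q.2) (y := (p.1 - q.1) ^ 2 + (p.2 - q.2) ^ 2)
    (by nlinarith [sq_nonneg (p.1 - q.1)])
  rw [Prod.dist_eq, Real.dist_eq, Real.dist_eq]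
  exact max_lt (by linarith) (by linarith)

end modulus

/-! ### Partial derivatives on the rectangle and Taylor estimates -/

section partials

variable {a b c d : ℝ} {f : ℝ × ℝ → ℝ} {p : ℝ × ℝ}

theorem _root_.HasFDerivWithinAt.slice_fst {L : ℝ × ℝ →L[ℝ] ℝ}
    (h : HasFDerivWithinAt f L (rect a b c d) p) (hp : p ∈ rect a b c d) :
    HasDerivWithinAt (fun t => f (t, p.2)) (L (1, 0)) (Set.Icc a b) p.1 := by
  have h1 : HasDerivWithinAt (fun t : ℝ => (t, p.2)) ((1 : ℝ), (0 : ℝ)) (Set.Icc a b) p.1 :=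
    (hasDerivWithinAt_id _ _).prodMk (hasDerivWithinAt_const _ _ _)
  have h2 : Set.MapsTo (fun t : ℝ => (t, p.2)) (Set.Icc a b) (rect a b c d) :=
    fun t ht => ⟨ht, hp.2⟩
  exact HasFDerivWithinAt.comp_hasDerivWithinAt (l := f) p.1 (by exact h) h1 h2

theorem _root_.HasFDerivWithinAt.slice_snd {L : ℝ × ℝ →L[ℝ] ℝ}
    (h : HasFDerivWithinAt f L (rect a b c d) p) (hp : p ∈ rect a b c d) :
    HasDerivWithinAt (fun t => f (p.1, t)) (L (0, 1)) (Set.Icc c d) p.2 := by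
  have h1 : HasDerivWithinAt (fun t : ℝ => (p.1, t)) ((0 : ℝ), (1 : ℝ)) (Set.Icc c d) p.2 :=
    (hasDerivWithinAt_const _ _ _).prodMk (hasDerivWithinAt_id _ _)
  have h2 : Set.MapsTo (fun t : ℝ => (p.1, t)) (Set.Icc c d) (rect a b c d) :=
    fun t ht => ⟨hp.1, ht⟩
  exact HasFDerivWithinAt.comp_hasDerivWithinAt (l := f) p.2 (by exact h) h1 h2

theorem _root_.HasFDerivWithinAt.partialX_eq (hab : a < b) {L : ℝ × ℝ →L[ℝ] ℝ}
    (h : HasFDerivWithinAt f L (rect a b c d) p) (hp : p ∈ rect a b c d) :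
    partialX a b f p = L (1, 0) :=
  (h.slice_fst hp).derivWithin (uniqueDiffOn_Icc hab p.1 hp.1)

theorem _root_.HasFDerivWithinAt.partialY_eq (hcd : c < d) {L : ℝ × ℝ →L[ℝ] ℝ}
    (h : HasFDerivWithinAt f L (rect a b c d) p) (hp : p ∈ rect a b c d) :
    partialY c d f p = L (0, 1) :=
  (h.slice_snd hp).derivWithin (uniqueDiffOn_Icc hcd p.2 hp.2)

theorem hasDerivWithinAt_partialX (hab : a < b) (hf : DifferentiableOn ℝ f (rect a b c d))
    (hp : p ∈ rect a b c d) :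
    HasDerivWithinAt (fun t => f (t, p.2)) (partialX a b f p) (Set.Icc a b) p.1 := by
  have h := (hf p hp).hasFDerivWithinAt
  rw [h.partialX_eq hab hp]
  exact h.slice_fst hp

theorem hasDerivWithinAt_partialY (hcd : c < d) (hf : DifferentiableOn ℝ f (rect a b c d))
    (hp : p ∈ rect a b c d) :
    HasDerivWithinAt (fun t => f (p.1, t)) (partialY c d f p) (Set.Icc c d) p.2 := by
  have h := (hf p hp).hasFDerivWithinAt
  rw [h.partialY_eq hcd hp]
  exact h.slice_snd hp

theorem contDiffOn_partialX (hab : a < b) (hcd : c < d) {n : ℕ}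
    (hf : ContDiffOn ℝ (n + 1 : ℕ) f (rect a b c d)) :
    ContDiffOn ℝ n (partialX a b f) (rect a b c d) := by
  have h1 : ContDiffOn ℝ n (fderivWithin ℝ f (rect a b c d)) (rect a b c d) :=
    hf.fderivWithin (uniqueDiffOn_rect hab hcd) (by norm_cast)
  refine (h1.clm_apply (contDiffOn_const (c := ((1 : ℝ), (0 : ℝ))))).congr fun p hp => ?_
  exact ((hf.differentiableOn (by norm_cast)) p hp).hasFDerivWithinAt.partialX_eq hab hp

theorem contDiffOn_partialY (hab : a < b) (hcd : c < d) {n : ℕ}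
    (hf : ContDiffOn ℝ (n + 1 : ℕ) f (rect a b c d)) :
    ContDiffOn ℝ n (partialY c d f) (rect a b c d) := by
  have h1 : ContDiffOn ℝ n (fderivWithin ℝ f (rect a b c d)) (rect a b c d) :=
    hf.fderivWithin (uniqueDiffOn_rect hab hcd) (by norm_cast)
  refine (h1.clm_apply (contDiffOn_const (c := ((0 : ℝ), (1 : ℝ))))).congr fun p hp => ?_
  exact ((hf.differentiableOn (by norm_cast)) p hp).hasFDerivWithinAt.partialY_eq hcd hp

theorem contDiffOn_iterate_partialX (hab : a < b) (hcd : c < d) (k : ℕ) {n : ℕ} {f : ℝ × ℝ → ℝ}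
    (hf : ContDiffOn ℝ (n + k : ℕ) f (rect a b c d)) :
    ContDiffOn ℝ n ((partialX a b)^[k] f) (rect a b c d) := by
  induction k generalizing f with
  | zero => exact hf
  | succ k ih => exact ih (contDiffOn_partialX hab hcd hf)

theorem contDiffOn_iterate_partialY (hab : a < b) (hcd : c < d) (k : ℕ) {n : ℕ} {f : ℝ × ℝ → ℝ}
    (hf : ContDiffOn ℝ (n + k : ℕ) f (rect a b c d)) :
    ContDiffOn ℝ n ((partialY c d)^[k] f) (rect a b c d) := by
  induction k generalizing f with
  | zero => exact hf
  | succ k ih => exact ih (contDiffOn_partialY hab hcd hf)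

theorem continuousOn_partialD (hab : a < b) (hcd : c < d) {α : ℕ × ℕ} {s : ℕ}
    (hα : α.1 + α.2 = s) (hf : ContDiffOn ℝ s f (rect a b c d)) :
    ContinuousOn (partialD a b c d α f) (rect a b c d) := by
  have h1 := contDiffOn_iterate_partialY hab hcd α.2 (n := α.1) (by rwa [hα])
  have h2 := contDiffOn_iterate_partialX hab hcd α.1 (n := 0) (by rwa [zero_add])
  exact h2.continuousOn

theorem modulus_le_modulusD {α : ℕ × ℕ} {s : ℕ} (hα : α.1 + α.2 = s) (t : ℝ) :
    modulus (rect a b c d) (partialD a b c d α f) t ≤ modulusD a b c d s f t :=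
  Finset.le_sup' (fun α => modulus (rect a b c d) (partialD a b c d α f) t)
    (Finset.HasAntidiagonal.mem_antidiagonal.2 hα)

theorem modulusD_nonneg (s : ℕ) (t : ℝ) : 0 ≤ modulusD a b c d s f t :=
  (modulus_nonneg _ _ t).trans (modulus_le_modulusD (α := (0, s)) (by simp) t)

theorem exists_modulusD_le (hab : a < b) (hcd : c < d) {s : ℕ}
    (hf : ContDiffOn ℝ s f (rect a b c d)) {ε : ℝ} (hε : 0 < ε) :
    ∃ τ > 0, ∀ t < τ, modulusD a b c d s f t ≤ ε := by
  have h : ∀ α ∈ Finset.HasAntidiagonal.antidiagonal s, ∀ᶠ τ in 𝓝[>] (0 : ℝ), ∀ t < τ,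
      modulus (rect a b c d) (partialD a b c d α f) t ≤ ε := by
    intro α hα
    obtain ⟨τ, hτ, h⟩ := exists_modulus_le
      (continuousOn_partialD hab hcd (Finset.HasAntidiagonal.mem_antidiagonal.1 hα) hf) hε
    filter_upwards [Ioo_mem_nhdsGT hτ] with σ hσ t ht
    exact h t (ht.trans hσ.2)
  obtain ⟨τ, h1, h2⟩ := (((Finset.eventually_all _).2 h).and self_mem_nhdsWithin).exists
  exact ⟨τ, h2, fun t ht => Finset.sup'_le _ _ fun α hα => h1 α hα t ht⟩

/-- The mean value inequality for `g t - e * t`. -/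
theorem abs_sub_linear_le {g g' : ℝ → ℝ} {x y e M : ℝ}
    (hg : ∀ t ∈ Set.uIcc y x, HasDerivWithinAt g (g' t) (Set.uIcc y x) t)
    (hM : ∀ t ∈ Set.uIcc y x, |g' t - e| ≤ M) : |g x - g y - e * (x - y)| ≤ M * |x - y| := by
  have h1 : ∀ t ∈ Set.uIcc y x,
      HasDerivWithinAt (fun t => g t - e * t) (g' t - e) (Set.uIcc y x) t := fun t ht => by
    have := (hg t ht).sub ((hasDerivWithinAt_id t (Set.uIcc y x)).const_mul e)
    exact this.congr_deriv (by simp)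
  have := (convex_uIcc y x).norm_image_sub_le_of_norm_hasDerivWithin_le h1 hM
    Set.left_mem_uIcc Set.right_mem_uIcc
  rw [Real.norm_eq_abs, Real.norm_eq_abs] at this
  convert this using 2
  ring

theorem abs_sub_quadratic_le {g g' g'' : ℝ → ℝ} {x y e M : ℝ}
    (hg : ∀ t ∈ Set.uIcc y x, HasDerivWithinAt g (g' t) (Set.uIcc y x) t)
    (hg' : ∀ t ∈ Set.uIcc y x, HasDerivWithinAt g' (g'' t) (Set.uIcc y x) t)
    (hM : ∀ t ∈ Set.uIcc y x, |g'' t - e| ≤ M) :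
    |g x - g y - g' y * (x - y) - e / 2 * (x - y) ^ 2| ≤ M * |x - y| ^ 2 := by
  have hM0 : 0 ≤ M := (abs_nonneg _).trans (hM y Set.left_mem_uIcc)
  have h1 : ∀ t ∈ Set.uIcc y x, HasDerivWithinAt (fun t => g t - e / 2 * (t - y) ^ 2)
      (g' t - e * (t - y)) (Set.uIcc y x) t := fun t ht => by
    have := (hg t ht).sub ((((hasDerivWithinAt_id t (Set.uIcc y x)).sub_const y).pow 2).const_mul
      (e / 2))
    refine this.congr_deriv ?_
    simp; ring
  have h2 : ∀ t ∈ Set.uIcc y x, |g' t - e * (t - y) - g' y| ≤ M * |x - y| := fun t ht => by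
    have hs : Set.uIcc y t ⊆ Set.uIcc y x := Set.uIcc_subset_uIcc_left ht
    have := abs_sub_linear_le (fun τ hτ => (hg' τ (hs hτ)).mono hs) fun τ hτ => hM τ (hs hτ)
    rw [show g' t - e * (t - y) - g' y = g' t - g' y - e * (t - y) by ring]
    exact this.trans (mul_le_mul_of_nonneg_left (Set.abs_sub_left_of_mem_uIcc ht) hM0)
  have := abs_sub_linear_le h1 h2
  convert this using 1
  · congr 1; ring
  · ring

/-- Go from `p` to `z` first horizontally, then vertically. The path stays in the rectangle and
within `ρ` of `p` in each coordinate, and each leg costs `M * ρ`. -/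
theorem abs_sub_taylor_one_le (hab : a < b) (hcd : c < d)
    (hf : DifferentiableOn ℝ f (rect a b c d)) {z : ℝ × ℝ} (hp : p ∈ rect a b c d)
    (hz : z ∈ rect a b c d) {ρ M : ℝ} (h1 : |z.1 - p.1| ≤ ρ) (h2 : |z.2 - p.2| ≤ ρ)
    (hX : ∀ w ∈ rect a b c d, |w.1 - p.1| ≤ ρ → |w.2 - p.2| ≤ ρ →
      |partialX a b f w - partialX a b f p| ≤ M)
    (hY : ∀ w ∈ rect a b c d, |w.1 - p.1| ≤ ρ → |w.2 - p.2| ≤ ρ →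
      |partialY c d f w - partialY c d f p| ≤ M) :
    |f z - (f p + partialX a b f p * (z.1 - p.1) + partialY c d f p * (z.2 - p.2))|
      ≤ 2 * M * ρ := by
  have hM0 : 0 ≤ M := (abs_nonneg _).trans (hX z hz h1 h2)
  have s1 : Set.uIcc p.1 z.1 ⊆ Set.Icc a b := Set.uIcc_subset_Icc hp.1 hz.1
  have s2 : Set.uIcc p.2 z.2 ⊆ Set.Icc c d := Set.uIcc_subset_Icc hp.2 hz.2
  have h0 : |p.2 - p.2| ≤ ρ := by simpa using (abs_nonneg _).trans h1
  have A := abs_sub_linear_le (g := fun t => f (t, p.2)) (g' := fun t => partialX a b f (t, p.2))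
    (x := z.1) (y := p.1) (e := partialX a b f p) (M := M)
    (fun t ht => (hasDerivWithinAt_partialX (p := (t, p.2)) hab hf ⟨s1 ht, hp.2⟩).mono s1)
    (fun t ht => hX (t, p.2) ⟨s1 ht, hp.2⟩ ((Set.abs_sub_left_of_mem_uIcc ht).trans h1) h0)
  have B := abs_sub_linear_le (g := fun t => f (z.1, t)) (g' := fun t => partialY c d f (z.1, t))
    (x := z.2) (y := p.2) (e := partialY c d f p) (M := M)
    (fun t ht => (hasDerivWithinAt_partialY (p := (z.1, t)) hcd hf ⟨hz.1, s2 ht⟩).mono s2)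
    (fun t ht => hY (z.1, t) ⟨hz.1, s2 ht⟩ h1 ((Set.abs_sub_left_of_mem_uIcc ht).trans h2))
  have A' := abs_le.1 (A.trans (mul_le_mul_of_nonneg_left h1 hM0))
  have B' := abs_le.1 (B.trans (mul_le_mul_of_nonneg_left h2 hM0))
  simp only [Prod.mk.eta] at A' B'
  rw [abs_le]
  constructor <;> linarith [A'.1, A'.2, B'.1, B'.2]

/-- Same path, with a second-order expansion on each leg. The vertical leg starts with the
`y`-derivative at `(z.1, p.2)`; moving it back to `p` produces the mixed term. Only the mixed
derivative taken first in `y` occurs, so symmetry of mixed derivatives is not needed. The three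
errors are `M * ρ ^ 2` each. -/
theorem abs_sub_taylor_two_le (hab : a < b) (hcd : c < d)
    (hf : ContDiffOn ℝ 2 f (rect a b c d)) {z : ℝ × ℝ} (hp : p ∈ rect a b c d)
    (hz : z ∈ rect a b c d) {ρ M : ℝ} (h1 : |z.1 - p.1| ≤ ρ) (h2 : |z.2 - p.2| ≤ ρ)
    (hXX : ∀ w ∈ rect a b c d, |w.1 - p.1| ≤ ρ → |w.2 - p.2| ≤ ρ →
      |partialX a b (partialX a b f) w - partialX a b (partialX a b f) p| ≤ M)
    (hXY : ∀ w ∈ rect a b c d, |w.1 - p.1| ≤ ρ → |w.2 - p.2| ≤ ρ →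
      |partialX a b (partialY c d f) w - partialX a b (partialY c d f) p| ≤ M)
    (hYY : ∀ w ∈ rect a b c d, |w.1 - p.1| ≤ ρ → |w.2 - p.2| ≤ ρ →
      |partialY c d (partialY c d f) w - partialY c d (partialY c d f) p| ≤ M) :
    |f z - (f p + partialX a b f p * (z.1 - p.1) + partialY c d f p * (z.2 - p.2)
      + partialX a b (partialX a b f) p / 2 * (z.1 - p.1) ^ 2
      + partialX a b (partialY c d f) p * ((z.1 - p.1) * (z.2 - p.2))
      + partialY c d (partialY c d f) p / 2 * (z.2 - p.2) ^ 2)| ≤ 3 * M * ρ ^ 2 := by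
  have hM0 : 0 ≤ M := (abs_nonneg _).trans (hXX z hz h1 h2)
  have hρ : 0 ≤ ρ := (abs_nonneg _).trans h1
  have s1 : Set.uIcc p.1 z.1 ⊆ Set.Icc a b := Set.uIcc_subset_Icc hp.1 hz.1
  have s2 : Set.uIcc p.2 z.2 ⊆ Set.Icc c d := Set.uIcc_subset_Icc hp.2 hz.2
  have h0 : |p.2 - p.2| ≤ ρ := by simpa using hρ
  have df : DifferentiableOn ℝ f (rect a b c d) := hf.differentiableOn (by norm_num)
  have dX : DifferentiableOn ℝ (partialX a b f) (rect a b c d) :=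
    (contDiffOn_partialX (n := 1) hab hcd hf).differentiableOn (by norm_num)
  have dY : DifferentiableOn ℝ (partialY c d f) (rect a b c d) :=
    (contDiffOn_partialY (n := 1) hab hcd hf).differentiableOn (by norm_num)
  have A := abs_sub_quadratic_le (g := fun t => f (t, p.2))
    (g' := fun t => partialX a b f (t, p.2))
    (g'' := fun t => partialX a b (partialX a b f) (t, p.2))
    (x := z.1) (y := p.1) (e := partialX a b (partialX a b f) p) (M := M)
    (fun t ht => (hasDerivWithinAt_partialX (p := (t, p.2)) hab df ⟨s1 ht, hp.2⟩).mono s1)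
    (fun t ht => (hasDerivWithinAt_partialX (p := (t, p.2)) hab dX ⟨s1 ht, hp.2⟩).mono s1)
    (fun t ht => hXX (t, p.2) ⟨s1 ht, hp.2⟩ ((Set.abs_sub_left_of_mem_uIcc ht).trans h1) h0)
  have B := abs_sub_quadratic_le (g := fun t => f (z.1, t))
    (g' := fun t => partialY c d f (z.1, t))
    (g'' := fun t => partialY c d (partialY c d f) (z.1, t))
    (x := z.2) (y := p.2) (e := partialY c d (partialY c d f) p) (M := M)
    (fun t ht => (hasDerivWithinAt_partialY (p := (z.1, t)) hcd df ⟨hz.1, s2 ht⟩).mono s2)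
    (fun t ht => (hasDerivWithinAt_partialY (p := (z.1, t)) hcd dY ⟨hz.1, s2 ht⟩).mono s2)
    (fun t ht => hYY (z.1, t) ⟨hz.1, s2 ht⟩ h1 ((Set.abs_sub_left_of_mem_uIcc ht).trans h2))
  have D := abs_sub_linear_le (g := fun t => partialY c d f (t, p.2))
    (g' := fun t => partialX a b (partialY c d f) (t, p.2))
    (x := z.1) (y := p.1) (e := partialX a b (partialY c d f) p) (M := M)
    (fun t ht => (hasDerivWithinAt_partialX (p := (t, p.2)) hab dY ⟨s1 ht, hp.2⟩).mono s1)
    (fun t ht => hXY (t, p.2) ⟨s1 ht, hp.2⟩ ((Set.abs_sub_left_of_mem_uIcc ht).trans h1) h0)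
  have A' := abs_le.1 (A.trans
    (mul_le_mul_of_nonneg_left (pow_le_pow_left₀ (abs_nonneg _) h1 2) hM0))
  have B' := abs_le.1 (B.trans
    (mul_le_mul_of_nonneg_left (pow_le_pow_left₀ (abs_nonneg _) h2 2) hM0))
  have D' := D.trans (mul_le_mul_of_nonneg_left h1 hM0)
  have E : |(partialY c d f (z.1, p.2) - partialY c d f (p.1, p.2)
      - partialX a b (partialY c d f) p * (z.1 - p.1)) * (z.2 - p.2)| ≤ M * ρ * ρ := by
    rw [abs_mul]
    exact mul_le_mul D' h2 (abs_nonneg _) (mul_nonneg hM0 hρ)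
  have E' := abs_le.1 E
  simp only [Prod.mk.eta] at A' B' E'
  rw [abs_le]
  constructor <;> nlinarith [A'.1, A'.2, B'.1, B'.2, E'.1, E'.2]

end partials

/-! ### Reproduction of quadratic polynomials and stability of the net -/

namespace Partition

variable {a b : ℝ} (X : Partition a b)

theorem coord_start (r : ℤ) : X.coord r (X.x (r - 1)) = 0 := by simp [coord]

theorem coord_s {r : ℤ} (h1 : 1 ≤ r) (h2 : r ≤ X.m) : X.coord r (X.s r) = 1 / 2 := by
  have := X.h_pos h1 h2
  rw [coord, div_eq_iff this.ne', s, h]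
  ring

theorem coord_comb (r : ℤ) {e g : ℝ} (h : e + g = 1) (t t' : ℝ) :
    X.coord r (e * t + g * t') = e * X.coord r t + g * X.coord r t' := by
  simp only [coord]
  linear_combination (X.x (r - 1) / X.h r) * h

theorem s_mem_Icc (r : ℤ) : X.s r ∈ Set.Icc (X.x (r - 1)) (X.x r) := by
  have := X.x_mono (show r - 1 ≤ r by omega)
  constructor <;> simp only [s] <;> linarith

theorem val_quadratic (hab : a < b) {r : ℤ} (h0 : 0 ≤ r) (hr : r ≤ X.m) (t k₀ k₁ k₂ : ℝ) :
    X.val r (fun i => k₀ + k₁ * (X.s i - t) + k₂ * ((X.x (i - 1) - t) * (X.x i - t)))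
      = k₀ + k₁ * (X.x r - t) + k₂ * (X.x r - t) ^ 2 := by
  have h1 := X.σ_add_σ' hab h0 hr
  have h2 := X.val_s hab h0 hr t
  have h3 := X.val_x_mul_x hab h0 hr t
  simp only [val] at *
  linear_combination k₀ * h1 + k₁ * h2 + k₂ * h3

/-- The coefficients with index in `[r - 1, r + 1]` use nodes between `x_{r-3}` and `x_{r+2}`, that
is, two further intervals on either side of `[x_{r-1}, x_r]`. -/
theorem abs_sub_le_of_mem_window (hab : a < b) {r : ℤ} {t t' H : ℝ} (hH : X.maxStep ≤ H)
    (ht : t ∈ Set.Icc (X.x (r - 3)) (X.x (r + 2))) (ht' : t' ∈ Set.Icc (X.x (r - 1)) (X.x r)) :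
    |t - t'| ≤ 3 * H := by
  have h1 := X.x_sub_x_le hab (r - 3) 3
  have h2 := X.x_sub_x_le hab (r - 1) 3
  rw [show r - 3 + ((3 : ℕ) : ℤ) = r by push_cast; ring] at h1
  rw [show r - 1 + ((3 : ℕ) : ℤ) = r + 2 by push_cast; ring] at h2
  push_cast at h1 h2
  rw [abs_le]
  constructor <;> linarith [ht.1, ht.2, ht'.1, ht'.2]

theorem x_mem_window {r i : ℤ} (h1 : r - 3 ≤ i) (h2 : i ≤ r + 2) :
    X.x i ∈ Set.Icc (X.x (r - 3)) (X.x (r + 2)) := ⟨X.x_mono h1, X.x_mono h2⟩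

theorem s_mem_window {r i : ℤ} (h1 : r - 2 ≤ i) (h2 : i ≤ r + 2) :
    X.s i ∈ Set.Icc (X.x (r - 3)) (X.x (r + 2)) :=
  ⟨(X.x_mono (by omega)).trans (X.s_mem_Icc i).1, (X.s_mem_Icc i).2.trans (X.x_mono h2)⟩

end Partition

/-- The quadratic polynomial with the value `e` and the partial derivatives `e₁, …, e₂₂` at `p`. -/
noncomputable def quad (e e₁ e₂ e₁₁ e₁₂ e₂₂ : ℝ) (p z : ℝ × ℝ) : ℝ :=
  e + e₁ * (z.1 - p.1) + e₂ * (z.2 - p.2) + e₁₁ / 2 * (z.1 - p.1) ^ 2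
    + e₁₂ * ((z.1 - p.1) * (z.2 - p.2)) + e₂₂ / 2 * (z.2 - p.2) ^ 2

/-- The Bernstein-Bézier coefficients of the quadratic polynomial with the value `e` and the partial
derivatives `e₁, …, e₂₂` at the origin on the rectangle `[U₀, U₁] × [V₀, V₁]`. -/
noncomputable def quadNet (e e₁ e₂ e₁₁ e₁₂ e₂₂ U₀ U₁ V₀ V₁ : ℝ) : Fin 8 → ℝ :=
  ![quad e e₁ e₂ e₁₁ e₁₂ e₂₂ 0 (U₀, V₀), quad e e₁ e₂ e₁₁ e₁₂ e₂₂ 0 (U₁, V₀),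
    quad e e₁ e₂ e₁₁ e₁₂ e₂₂ 0 (U₀, V₁), quad e e₁ e₂ e₁₁ e₁₂ e₂₂ 0 (U₁, V₁),
    e + e₁ * ((U₀ + U₁) / 2) + e₂ * V₀ + e₁₁ / 2 * (U₀ * U₁) + e₁₂ * ((U₀ + U₁) / 2 * V₀)
      + e₂₂ / 2 * V₀ ^ 2,
    e + e₁ * ((U₀ + U₁) / 2) + e₂ * V₁ + e₁₁ / 2 * (U₀ * U₁) + e₁₂ * ((U₀ + U₁) / 2 * V₁)
      + e₂₂ / 2 * V₁ ^ 2,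
    e + e₁ * U₀ + e₂ * ((V₀ + V₁) / 2) + e₁₁ / 2 * U₀ ^ 2 + e₁₂ * (U₀ * ((V₀ + V₁) / 2))
      + e₂₂ / 2 * (V₀ * V₁),
    e + e₁ * U₁ + e₂ * ((V₀ + V₁) / 2) + e₁₁ / 2 * U₁ ^ 2 + e₁₂ * (U₁ * ((V₀ + V₁) / 2))
      + e₂₂ / 2 * (V₀ * V₁)]

section quadNet

variable (e e₁ e₂ e₁₁ e₁₂ e₂₂ h k u v m n : ℝ)

/-- Coordinates are centred at the point with local coordinates `(u, v)`, so the derivative there is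
just `e₁`, scaled by the step. The numbers `m` and `n` are arbitrary because both jumps of a single
polynomial vanish. -/
theorem splU_quadNet : splU (quadNet e e₁ e₂ e₁₁ e₁₂ e₂₂ (-(h * u)) (h * (1 - u)) (-(k * v))
    (k * (1 - v))) u v m n = e₁ * h := by
  simp [splU, jumpMain, jumpAnti, quadNet, quad]; ring

theorem splV_quadNet : splV (quadNet e e₁ e₂ e₁₁ e₁₂ e₂₂ (-(h * u)) (h * (1 - u)) (-(k * v))
    (k * (1 - v))) u v m n = e₂ * k := by
  simp [splV, jumpMain, jumpAnti, quadNet, quad]; ring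

theorem splUU_quadNet : splUU (quadNet e e₁ e₂ e₁₁ e₁₂ e₂₂ (-(h * u)) (h * (1 - u)) (-(k * v))
    (k * (1 - v))) m n = e₁₁ * h * h := by
  simp [splUU, jumpMain, jumpAnti, quadNet, quad]; ring

theorem splUV_quadNet : splUV (quadNet e e₁ e₂ e₁₁ e₁₂ e₂₂ (-(h * u)) (h * (1 - u)) (-(k * v))
    (k * (1 - v))) m n = e₁₂ * h * k := by
  simp [splUV, jumpMain, jumpAnti, quadNet, quad]; ring

theorem splVV_quadNet : splVV (quadNet e e₁ e₂ e₁₁ e₁₂ e₂₂ (-(h * u)) (h * (1 - u)) (-(k * v))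
    (k * (1 - v))) m n = e₂₂ * k * k := by
  simp [splVV, jumpMain, jumpAnti, quadNet, quad]; ring

end quadNet

namespace Grid

variable {a b c d : ℝ} (P : Grid a b c d)

/-- For `S₂` the first moments vanish and the second ones change `s_i²` into `x_{i-1} x_i`. For
`W₂*` this is `2 s_i² - (x_{i-1}² + x_i²) / 2 = x_{i-1} x_i`, and the mean over the four corners
keeps `xy` at `s_i t_j`. -/
theorem coeff_quad (Q : Kind) {i j : ℤ} (hi : 0 ≤ i) (hi' : i ≤ P.X.m + 1) (hj : 0 ≤ j)
    (hj' : j ≤ P.Y.m + 1) (e e₁ e₂ e₁₁ e₁₂ e₂₂ : ℝ) (p : ℝ × ℝ) :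
    Q.coeff P i j (quad e e₁ e₂ e₁₁ e₁₂ e₂₂ p) =
      e + e₁ * (P.X.s i - p.1) + e₂ * (P.Y.s j - p.2)
        + e₁₁ / 2 * ((P.X.x (i - 1) - p.1) * (P.X.x i - p.1))
        + e₁₂ * ((P.X.s i - p.1) * (P.Y.s j - p.2))
        + e₂₂ / 2 * ((P.Y.x (j - 1) - p.2) * (P.Y.x j - p.2)) := by
  have hs : P.X.s i = (P.X.x (i - 1) + P.X.x i) / 2 := rfl
  have ht : P.Y.s j = (P.Y.x (j - 1) + P.Y.x j) / 2 := rfl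
  cases Q with
  | S₂ =>
    have m1 := P.X.moment_one i
    have m2 := P.X.moment_two i hi hi'
    have n1 := P.Y.moment_one j
    have n2 := P.Y.moment_two j hj hj'
    simp only [Kind.coeff, μS, M, quad]
    rw [hs] at m1 m2 ⊢
    rw [ht] at n1 n2 ⊢
    linear_combination (e₁ + e₁₁ * ((P.X.x (i - 1) + P.X.x i) / 2 - p.1)
        + e₁₂ * ((P.Y.x (j - 1) + P.Y.x j) / 2 - p.2)) * m1 + e₁₁ / 2 * m2
      + (e₂ + e₂₂ * ((P.Y.x (j - 1) + P.Y.x j) / 2 - p.2)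
        + e₁₂ * ((P.X.x (i - 1) + P.X.x i) / 2 - p.1)) * n1 + e₂₂ / 2 * n2
  | W₂star =>
    simp only [Kind.coeff, μW, M, A, quad]
    rw [hs, ht]
    ring

theorem coeff_add (Q : Kind) (i j : ℤ) (f g : ℝ × ℝ → ℝ) :
    Q.coeff P i j (f + g) = Q.coeff P i j f + Q.coeff P i j g := by
  cases Q <;> simp only [Kind.coeff, μS, μW, Pi.add_apply] <;> ring

/-- For `S₂` the central weight is at most `1 + 4` and the four others at most `1` each, which gives
9; for `W₂*` the sum is 3. -/
theorem abs_coeff_le (Q : Kind) {r s i j : ℤ} (hi : r - 1 ≤ i) (hi' : i ≤ r + 1) (hj : s - 1 ≤ j)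
    (hj' : j ≤ s + 1) {g : ℝ × ℝ → ℝ} {K : ℝ}
    (hg : ∀ z : ℝ × ℝ, z.1 ∈ Set.Icc (P.X.x (r - 3)) (P.X.x (r + 2)) →
      z.2 ∈ Set.Icc (P.Y.x (s - 3)) (P.Y.x (s + 2)) → |g z| ≤ K) :
    |Q.coeff P i j g| ≤ 9 * K := by
  have hs := fun {l : ℤ} (h1 : i - 1 ≤ l) (h2 : l ≤ i + 1) =>
    P.X.s_mem_window (r := r) (i := l) (by omega) (by omega)
  have ht := fun {l : ℤ} (h1 : j - 1 ≤ l) (h2 : l ≤ j + 1) =>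
    P.Y.s_mem_window (r := s) (i := l) (by omega) (by omega)
  have hx := fun {l : ℤ} (h1 : i - 1 ≤ l) (h2 : l ≤ i) =>
    P.X.x_mem_window (r := r) (i := l) (by omega) (by omega)
  have hy := fun {l : ℤ} (h1 : j - 1 ≤ l) (h2 : l ≤ j) =>
    P.Y.x_mem_window (r := s) (i := l) (by omega) (by omega)
  have k0 : |g (P.M i j)| ≤ K := hg _ (hs (by omega) (by omega)) (ht (by omega) (by omega))
  cases Q with
  | S₂ =>
    have k1 : |g (P.M (i - 1) j)| ≤ K := hg _ (hs (by omega) (by omega)) (ht (by omega) (by omega))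
    have k2 : |g (P.M (i + 1) j)| ≤ K := hg _ (hs (by omega) (by omega)) (ht (by omega) (by omega))
    have k3 : |g (P.M i (j - 1))| ≤ K := hg _ (hs (by omega) (by omega)) (ht (by omega) (by omega))
    have k4 : |g (P.M i (j + 1))| ≤ K := hg _ (hs (by omega) (by omega)) (ht (by omega) (by omega))
    have a0 := abs_le.1 k0
    have a1 := abs_le.1 (abs_mul_le_of_le_one k1 (P.X.abs_ca_le i))
    have a2 := abs_le.1 (abs_mul_le_of_le_one k2 (P.X.abs_cc_le i))
    have a3 := abs_le.1 (abs_mul_le_of_le_one k3 (P.Y.abs_ca_le j))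
    have a4 := abs_le.1 (abs_mul_le_of_le_one k4 (P.Y.abs_cc_le j))
    have b1 := abs_le.1 (abs_mul_le_of_le_one k0 (P.X.abs_ca_le i))
    have b2 := abs_le.1 (abs_mul_le_of_le_one k0 (P.X.abs_cc_le i))
    have b3 := abs_le.1 (abs_mul_le_of_le_one k0 (P.Y.abs_ca_le j))
    have b4 := abs_le.1 (abs_mul_le_of_le_one k0 (P.Y.abs_cc_le j))
    simp only [Kind.coeff, μS]
    rw [abs_le]
    constructor <;> linarith
  | W₂star =>
    have k1 := abs_le.1 (hg (P.A (i - 1) (j - 1)) (hx (by omega) (by omega))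
      (hy (by omega) (by omega)))
    have k2 := abs_le.1 (hg (P.A (i - 1) j) (hx (by omega) (by omega)) (hy (by omega) (by omega)))
    have k3 := abs_le.1 (hg (P.A i (j - 1)) (hx (by omega) (by omega)) (hy (by omega) (by omega)))
    have k4 := abs_le.1 (hg (P.A i j) (hx (by omega) (by omega)) (hy (by omega) (by omega)))
    have a0 := abs_le.1 k0
    simp only [Kind.coeff, μW]
    rw [abs_le]
    constructor <;> linarith

variable {P} in
theorem abs_net_le (hab : a < b) (hcd : c < d) {r s : ℤ} (hrs : P.IsBox r s) {φ : ℤ → ℤ → ℝ}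
    {K : ℝ} (hφ : ∀ i j, r - 1 ≤ i → i ≤ r + 1 → s - 1 ≤ j → j ≤ s + 1 → |φ i j| ≤ K)
    (l : Fin 8) : |P.net φ r s l| ≤ K := by
  obtain ⟨⟨h1, h2⟩, h3, h4⟩ := hrs
  have hX : ∀ r', r - 1 ≤ r' → r' ≤ r → ∀ ψ : ℤ → ℝ, (∀ i, r - 1 ≤ i → i ≤ r + 1 → |ψ i| ≤ K) →
      |P.X.val r' ψ| ≤ K := fun r' g1 g2 ψ hψ =>
    P.X.abs_val_le hab (by omega) (by omega) (hψ _ (by omega) (by omega))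
      (hψ _ (by omega) (by omega))
  have hY : ∀ s', s - 1 ≤ s' → s' ≤ s → ∀ ψ : ℤ → ℝ, (∀ j, s - 1 ≤ j → j ≤ s + 1 → |ψ j| ≤ K) →
      |P.Y.val s' ψ| ≤ K := fun s' g1 g2 ψ hψ =>
    P.Y.abs_val_le hcd (by omega) (by omega) (hψ _ (by omega) (by omega))
      (hψ _ (by omega) (by omega))
  have hXY : ∀ r' s', r - 1 ≤ r' → r' ≤ r → s - 1 ≤ s' → s' ≤ s →
      |P.X.val r' fun i => P.Y.val s' (φ i)| ≤ K := fun r' s' g1 g2 g3 g4 =>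
    hX r' g1 g2 _ fun i i1 i2 => hY s' g3 g4 _ fun j j1 j2 => hφ i j i1 i2 j1 j2
  have hE : ∀ s', s - 1 ≤ s' → s' ≤ s → |P.Y.val s' (φ r)| ≤ K := fun s' g3 g4 =>
    hY s' g3 g4 _ fun j j1 j2 => hφ r j (by omega) (by omega) j1 j2
  have hF : ∀ r', r - 1 ≤ r' → r' ≤ r → |P.X.val r' fun i => φ i s| ≤ K := fun r' g1 g2 =>
    hX r' g1 g2 _ fun i i1 i2 => hφ i s i1 i2 (by omega) (by omega)
  have b1 : r - 1 ≤ r := by omega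
  have b2 : s - 1 ≤ s := by omega
  fin_cases l
  · exact hXY _ _ le_rfl b1 le_rfl b2
  · exact hXY _ _ b1 le_rfl le_rfl b2
  · exact hXY _ _ le_rfl b1 b2 le_rfl
  · exact hXY _ _ b1 le_rfl b2 le_rfl
  · exact hE _ le_rfl b2
  · exact hE _ b2 le_rfl
  · exact hF _ le_rfl b1
  · exact hF _ b1 le_rfl

theorem net_add (φ ψ : ℤ → ℤ → ℝ) (r s : ℤ) :
    P.net (fun i j => φ i j + ψ i j) r s = P.net φ r s + P.net ψ r s := by
  ext l
  fin_cases l <;> simp [net, Partition.val] <;> ring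

variable {P} in
-- The blossom coefficients of `coeff_quad` are averaged by `val_quadratic` in each variable:
-- corners become values, and edge midpoints keep the blossom in the direction of the edge.
theorem net_coeff_quad (Q : Kind) (hab : a < b) (hcd : c < d) {r s : ℤ} (hrs : P.IsBox r s)
    (e e₁ e₂ e₁₁ e₁₂ e₂₂ : ℝ) (p : ℝ × ℝ) :
    P.net (fun i j => Q.coeff P i j (quad e e₁ e₂ e₁₁ e₁₂ e₂₂ p)) r s =
      quadNet e e₁ e₂ e₁₁ e₁₂ e₂₂ (P.X.x (r - 1) - p.1) (P.X.x r - p.1)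
        (P.Y.x (s - 1) - p.2) (P.Y.x s - p.2) := by
  obtain ⟨⟨h1, h2⟩, h3, h4⟩ := hrs
  have hY : ∀ i s' : ℤ, 0 ≤ i → i ≤ P.X.m + 1 → 0 ≤ s' → s' ≤ P.Y.m →
      P.Y.val s' (fun j => Q.coeff P i j (quad e e₁ e₂ e₁₁ e₁₂ e₂₂ p)) =
      (e + e₂ * (P.Y.x s' - p.2) + e₂₂ / 2 * (P.Y.x s' - p.2) ^ 2)
        + (e₁ + e₁₂ * (P.Y.x s' - p.2)) * (P.X.s i - p.1)
        + e₁₁ / 2 * ((P.X.x (i - 1) - p.1) * (P.X.x i - p.1)) := by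
    intro i s' i1 i2 g1 g2
    have := P.Y.val_quadratic hcd g1 g2 p.2
      (e + e₁ * (P.X.s i - p.1) + e₁₁ / 2 * ((P.X.x (i - 1) - p.1) * (P.X.x i - p.1)))
      (e₂ + e₁₂ * (P.X.s i - p.1)) (e₂₂ / 2)
    simp only [Partition.val] at this ⊢
    rw [P.coeff_quad Q i1 i2 g1 (by omega), P.coeff_quad Q i1 i2 (by omega) (by omega)]
    linear_combination this
  have hX : ∀ r' : ℤ, 0 ≤ r' → r' ≤ P.X.m →
      P.X.val r' (fun i => Q.coeff P i s (quad e e₁ e₂ e₁₁ e₁₂ e₂₂ p)) =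
      e + e₁ * (P.X.x r' - p.1) + e₂ * (P.Y.s s - p.2) + e₁₁ / 2 * (P.X.x r' - p.1) ^ 2
        + e₁₂ * ((P.X.x r' - p.1) * (P.Y.s s - p.2))
        + e₂₂ / 2 * ((P.Y.x (s - 1) - p.2) * (P.Y.x s - p.2)) := by
    intro r' g1 g2
    have := P.X.val_quadratic hab g1 g2 p.1
      (e + e₂ * (P.Y.s s - p.2) + e₂₂ / 2 * ((P.Y.x (s - 1) - p.2) * (P.Y.x s - p.2)))
      (e₁ + e₁₂ * (P.Y.s s - p.2)) (e₁₁ / 2)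
    simp only [Partition.val] at this ⊢
    rw [P.coeff_quad Q g1 (by omega) (by omega) (by omega),
      P.coeff_quad Q (by omega) (by omega) (by omega) (by omega)]
    linear_combination this
  have hXY : ∀ r' s' : ℤ, 0 ≤ r' → r' ≤ P.X.m → 0 ≤ s' → s' ≤ P.Y.m →
      P.X.val r' (fun i => P.Y.val s' fun j => Q.coeff P i j (quad e e₁ e₂ e₁₁ e₁₂ e₂₂ p)) =
      quad e e₁ e₂ e₁₁ e₁₂ e₂₂ 0 (P.X.x r' - p.1, P.Y.x s' - p.2) := by
    intro r' s' g1 g2 g3 g4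
    have := P.X.val_quadratic hab g1 g2 p.1
      (e + e₂ * (P.Y.x s' - p.2) + e₂₂ / 2 * (P.Y.x s' - p.2) ^ 2)
      (e₁ + e₁₂ * (P.Y.x s' - p.2)) (e₁₁ / 2)
    have y1 := hY r' s' g1 (by omega) g3 g4
    have y2 := hY (r' + 1) s' (by omega) (by omega) g3 g4
    rw [Partition.val, y1, y2]
    simp only [Partition.val] at this
    simp only [quad, Prod.fst_zero, Prod.snd_zero]
    linear_combination this
  have xs : P.X.s r = (P.X.x (r - 1) + P.X.x r) / 2 := rfl
  have ys : P.Y.s s = (P.Y.x (s - 1) + P.Y.x s) / 2 := rfl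
  have e0 := hXY (r - 1) (s - 1) (by omega) (by omega) (by omega) (by omega)
  have e1 := hXY r (s - 1) (by omega) (by omega) (by omega) (by omega)
  have e2 := hXY (r - 1) s (by omega) (by omega) (by omega) (by omega)
  have e3 := hXY r s (by omega) (by omega) (by omega) (by omega)
  have e4 := hY r (s - 1) (by omega) (by omega) (by omega) (by omega)
  have e5 := hY r s (by omega) (by omega) (by omega) (by omega)
  have e6 := hX (r - 1) (by omega) (by omega)
  have e7 := hX r (by omega) (by omega)
  rw [xs] at e4 e5
  rw [ys] at e6 e7
  unfold net quadNet
  rw [e0, e1, e2, e3, e4, e5, e6, e7]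
  congr! 5
  · ring
  congr! 1
  · ring
  congr! 1
  · ring
  congr! 1
  ring

variable {P} in
-- Here reproduction and stability meet: `w` is the net of the remainder `f - q`, and the net of `q`
-- is exact.
theorem exists_net_coeff_eq (Q : Kind) (hab : a < b) (hcd : c < d) {r s : ℤ} (hrs : P.IsBox r s)
    (e e₁ e₂ e₁₁ e₁₂ e₂₂ : ℝ) {p : ℝ × ℝ} {f : ℝ × ℝ → ℝ} {K : ℝ}
    (hf : ∀ z : ℝ × ℝ, z.1 ∈ Set.Icc (P.X.x (r - 3)) (P.X.x (r + 2)) →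
      z.2 ∈ Set.Icc (P.Y.x (s - 3)) (P.Y.x (s + 2)) →
      |f z - quad e e₁ e₂ e₁₁ e₁₂ e₂₂ p z| ≤ K) :
    ∃ w : Fin 8 → ℝ, (∀ l, |w l| ≤ 9 * K) ∧ P.net (fun i j => Q.coeff P i j f) r s =
      quadNet e e₁ e₂ e₁₁ e₁₂ e₂₂ (-(P.X.h r * P.X.coord r p.1))
        (P.X.h r * (1 - P.X.coord r p.1)) (-(P.Y.h s * P.Y.coord s p.2))
        (P.Y.h s * (1 - P.Y.coord s p.2)) + w := by
  have hX := P.X.h_pos hrs.1.1 hrs.1.2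
  have hY := P.Y.h_pos hrs.2.1 hrs.2.2
  have hx : P.X.h r * P.X.coord r p.1 = p.1 - P.X.x (r - 1) := mul_div_cancel₀ _ hX.ne'
  have hy : P.Y.h s * P.Y.coord s p.2 = p.2 - P.Y.x (s - 1) := mul_div_cancel₀ _ hY.ne'
  set q := quad e e₁ e₂ e₁₁ e₁₂ e₂₂ p with hq
  refine ⟨P.net (fun i j => Q.coeff P i j (f - q)) r s, fun l => abs_net_le hab hcd hrs
    (fun i j i1 i2 j1 j2 => P.abs_coeff_le Q i1 i2 j1 j2 hf) l, ?_⟩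
  rw [mul_sub, mul_sub, hx, hy, mul_one, mul_one]
  have h1 := net_coeff_quad Q hab hcd hrs e e₁ e₂ e₁₁ e₁₂ e₂₂ p
  have h2 := P.net_add (fun i j => Q.coeff P i j q) (fun i j => Q.coeff P i j (f - q)) r s
  simp only [← coeff_add, add_sub_cancel] at h2
  rw [h2, h1]
  congr 2
  · ring
  · rw [Partition.h]; ring
  · ring
  · rw [Partition.h]; ring

end Grid

/-! ### Derivatives of the quasi-interpolant, in boxes and in triangles -/

section derivatives

variable {a b c d : ℝ} {P : Grid a b c d} (Q : Kind) (f : ℝ × ℝ → ℝ)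

theorem Kind.apply_eq_piece {r s : ℤ} (hab : a < b) (hcd : c < d)
    (hrs : P.IsBox r s) {p : ℝ × ℝ} (hp : p ∈ P.box r s) :
    Q.apply P f p = P.piece (fun i j => Q.coeff P i j f) r s p := by
  rw [Q.apply_eq P hab hcd f (P.box_subset_rect r s hp), P.splineJet_eq _ hab hcd hrs hp]
  rfl

theorem Kind.contDiffOn_apply (hab : a < b) (hcd : c < d) :
    ContDiffOn ℝ 1 (Q.apply P f) (rect a b c d) :=
  (P.contDiffOn_splineJet _ hab hcd).congr fun _ hp => Q.apply_eq P hab hcd f hp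

theorem Kind.hasFDerivWithinAt_apply {r s : ℤ} (hab : a < b) (hcd : c < d)
    (hrs : P.IsBox r s) {p : ℝ × ℝ} (hp : p ∈ P.box r s) :
    HasFDerivWithinAt (Q.apply P f) (grad (P.pieceX (fun i j => Q.coeff P i j f) r s p)
      (P.pieceY (fun i j => Q.coeff P i j f) r s p)) (rect a b c d) p := by
  have h := P.hasFDerivWithinAt_splineJet (fun i j => Q.coeff P i j f) hab hcd (p := p)
  have := h.congr (fun _ hp => Q.apply_eq P hab hcd f hp)
    (Q.apply_eq P hab hcd f (P.box_subset_rect r s hp))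
  rwa [P.splineJet_eq _ hab hcd hrs hp] at this

theorem Kind.partialX_apply {r s : ℤ} (hab : a < b) (hcd : c < d)
    (hrs : P.IsBox r s) {p : ℝ × ℝ} (hp : p ∈ P.box r s) :
    partialX a b (Q.apply P f) p = P.pieceX (fun i j => Q.coeff P i j f) r s p := by
  rw [(Q.hasFDerivWithinAt_apply f hab hcd hrs hp).partialX_eq hab (P.box_subset_rect r s hp),
    grad_apply]
  simp

theorem Kind.partialY_apply {r s : ℤ} (hab : a < b) (hcd : c < d)
    (hrs : P.IsBox r s) {p : ℝ × ℝ} (hp : p ∈ P.box r s) :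
    partialY c d (Q.apply P f) p = P.pieceY (fun i j => Q.coeff P i j f) r s p := by
  rw [(Q.hasFDerivWithinAt_apply f hab hcd hrs hp).partialY_eq hcd (P.box_subset_rect r s hp),
    grad_apply]
  simp

end derivatives

namespace Grid

variable {a b c d : ℝ} {P : Grid a b c d}

theorem convex_halfPlane (P : Grid a b c d) (r s : ℤ) (e g k : ℝ) :
    Convex ℝ {p : ℝ × ℝ | e * (P.coord r s p).1 + g * (P.coord r s p).2 ≤ k} := by
  intro p hp q hq α β hα hβ h
  simp only [Set.mem_ofPred_eq, coord] at hp hq ⊢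
  rw [show (α • p + β • q).1 = α * p.1 + β * q.1 by simp,
    show (α • p + β • q).2 = α * p.2 + β * q.2 by simp, P.X.coord_comb r h, P.Y.coord_comb s h]
  have : k = α * k + β * k := by rw [← add_mul, h, one_mul]
  nlinarith [mul_le_mul_of_nonneg_left hp hα, mul_le_mul_of_nonneg_left hq hβ]

theorem convex_box (P : Grid a b c d) (r s : ℤ) : Convex ℝ (P.box r s) :=
  (convex_Icc _ _).prod (convex_Icc _ _)

/-- A triangular cell lies in one subrectangle and on one side of each of its diagonals. -/
theorem IsCell.exists_box {T : Set (ℝ × ℝ)} (hT : P.IsCell T) :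
    ∃ r s : ℤ, ∃ m n : ℝ, P.IsBox r s ∧ |m| ≤ 1 ∧ |n| ≤ 1 ∧ ∀ p ∈ T, p ∈ P.box r s ∧
      max 0 ((P.coord r s p).1 - (P.coord r s p).2)
        = m * ((P.coord r s p).1 - (P.coord r s p).2) ∧
      max 0 ((P.coord r s p).1 + (P.coord r s p).2 - 1)
        = n * ((P.coord r s p).1 + (P.coord r s p).2 - 1) := by
  obtain ⟨r, s, ⟨h1, h2⟩, ⟨h3, h4⟩, hT⟩ := hT
  have x0 := P.X.coord_start r
  have x1 := P.X.coord_right h1 h2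
  have xs := P.X.coord_s h1 h2
  have y0 := P.Y.coord_start s
  have y1 := P.Y.coord_right h3 h4
  have ys := P.Y.coord_s h3 h4
  have hx := P.X.x_mono (show r - 1 ≤ r by omega)
  have hy := P.Y.x_mono (show s - 1 ≤ s by omega)
  have b00 : P.A (r - 1) (s - 1) ∈ P.box r s := ⟨⟨le_rfl, hx⟩, ⟨le_rfl, hy⟩⟩
  have b10 : P.A r (s - 1) ∈ P.box r s := ⟨⟨hx, le_rfl⟩, ⟨le_rfl, hy⟩⟩
  have b01 : P.A (r - 1) s ∈ P.box r s := ⟨⟨le_rfl, hx⟩, ⟨hy, le_rfl⟩⟩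
  have b11 : P.A r s ∈ P.box r s := ⟨⟨hx, le_rfl⟩, ⟨hy, le_rfl⟩⟩
  have bM : P.M r s ∈ P.box r s := ⟨P.X.s_mem_Icc r, P.Y.s_mem_Icc s⟩
  -- A triangle is a convex hull, so membership in the box and in two half-planes need only be
  -- checked at its three vertices.
  have key : ∀ (e g k e' g' k' : ℝ) (A B : ℝ × ℝ), T = convexHull ℝ {A, B, P.M r s} →
      A ∈ P.box r s → B ∈ P.box r s →
      (∀ D ∈ ({A, B, P.M r s} : Set (ℝ × ℝ)), e * (P.coord r s D).1 + g * (P.coord r s D).2 ≤ k ∧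
        e' * (P.coord r s D).1 + g' * (P.coord r s D).2 ≤ k') →
      ∀ p ∈ T, p ∈ P.box r s ∧ e * (P.coord r s p).1 + g * (P.coord r s p).2 ≤ k ∧
        e' * (P.coord r s p).1 + g' * (P.coord r s p).2 ≤ k' := by
    rintro e g k e' g' k' A B rfl hA hB hD
    refine convexHull_min (t := P.box r s ∩ ({p | e * (P.coord r s p).1 + g * (P.coord r s p).2 ≤ k}
      ∩ {p | e' * (P.coord r s p).1 + g' * (P.coord r s p).2 ≤ k'})) (fun D hD' => ?_)
      ((P.convex_box r s).inter
        ((P.convex_halfPlane r s e g k).inter (P.convex_halfPlane r s e' g' k')))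
    refine ⟨?_, hD D hD'⟩
    rcases hD' with rfl | rfl | rfl
    exacts [hA, hB, bM]
  have hd : ∀ {t e : ℝ}, 0 ≤ t → e = 1 → max 0 t = e * t := by
    rintro t e ht rfl; rw [max_eq_right ht, one_mul]
  have hd' : ∀ {t e : ℝ}, t ≤ 0 → e = 0 → max 0 t = e * t := by
    rintro t e ht rfl; rw [max_eq_left ht, zero_mul]
  rcases hT with hT | hT | hT | hT
  -- In each of the four cases `m` and `n` are `1` or `0` according to whether `u - v` and `u + v -
  -- 1` are nonnegative or nonpositive on the triangle.
  · refine ⟨r, s, 1, 0, ⟨⟨h1, h2⟩, h3, h4⟩, by simp, by simp, fun p hp => ?_⟩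
    obtain ⟨g1, g2, g3⟩ := key (-1) 1 0 1 1 1 _ _ hT b00 b10
      (by simp [coord, A, M, x0, x1, xs, y0, ys]; norm_num) p hp
    exact ⟨g1, hd (by linarith) rfl, hd' (by linarith) rfl⟩
  · refine ⟨r, s, 1, 1, ⟨⟨h1, h2⟩, h3, h4⟩, by simp, by simp, fun p hp => ?_⟩
    obtain ⟨g1, g2, g3⟩ := key (-1) 1 0 (-1) (-1) (-1) _ _ hT b10 b11
      (by simp [coord, A, M, x1, xs, y0, y1, ys]; norm_num) p hp
    exact ⟨g1, hd (by linarith) rfl, hd (by linarith) rfl⟩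
  · refine ⟨r, s, 0, 1, ⟨⟨h1, h2⟩, h3, h4⟩, by simp, by simp, fun p hp => ?_⟩
    obtain ⟨g1, g2, g3⟩ := key 1 (-1) 0 (-1) (-1) (-1) _ _ hT b11 b01
      (by simp [coord, A, M, x0, x1, xs, y1, ys]; norm_num) p hp
    exact ⟨g1, hd' (by linarith) rfl, hd (by linarith) rfl⟩
  · refine ⟨r, s, 0, 0, ⟨⟨h1, h2⟩, h3, h4⟩, by simp, by simp, fun p hp => ?_⟩
    obtain ⟨g1, g2, g3⟩ := key 1 (-1) 0 1 1 1 _ _ hT b01 b00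
      (by simp [coord, A, M, x0, xs, y0, y1, ys]; norm_num) p hp
    exact ⟨g1, hd' (by linarith) rfl, hd' (by linarith) rfl⟩

theorem partialX_of_eqOn (hab : a < b) {G g : ℝ × ℝ → ℝ} {O : Set (ℝ × ℝ)} (hO : IsOpen O)
    (hsub : O ⊆ rect a b c d) (h : Set.EqOn G g O) {p : ℝ × ℝ} (hp : p ∈ O) {e k : ℝ}
    (hg : ∀ t, g (t, p.2) = e * t + k) : partialX a b G p = e := by
  have h1 : ∀ᶠ t in 𝓝 p.1, G (t, p.2) = e * t + k := by
    have : ContinuousAt (fun t : ℝ => (t, p.2)) p.1 := by fun_prop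
    filter_upwards [this (hO.mem_nhds hp)] with t ht
    rw [h ht, hg]
  have h2 : HasDerivAt (fun t => e * t + k) e p.1 := by
    simpa using ((hasDerivAt_id p.1).const_mul e).add_const k
  exact (h2.congr_of_eventuallyEq h1).hasDerivWithinAt.derivWithin
    (uniqueDiffOn_Icc hab p.1 (hsub hp).1)

theorem partialY_of_eqOn (hcd : c < d) {G g : ℝ × ℝ → ℝ} {O : Set (ℝ × ℝ)} (hO : IsOpen O)
    (hsub : O ⊆ rect a b c d) (h : Set.EqOn G g O) {p : ℝ × ℝ} (hp : p ∈ O) {e k : ℝ}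
    (hg : ∀ t, g (p.1, t) = e * t + k) : partialY c d G p = e := by
  have h1 : ∀ᶠ t in 𝓝 p.2, G (p.1, t) = e * t + k := by
    have : ContinuousAt (fun t : ℝ => (p.1, t)) p.2 := by fun_prop
    filter_upwards [this (hO.mem_nhds hp)] with t ht
    rw [h ht, hg]
  have h2 : HasDerivAt (fun t => e * t + k) e p.2 := by
    simpa using ((hasDerivAt_id p.2).const_mul e).add_const k
  exact (h2.congr_of_eventuallyEq h1).hasDerivWithinAt.derivWithin
    (uniqueDiffOn_Icc hcd p.2 (hsub hp).2)

section second

variable (Q : Kind) (f : ℝ × ℝ → ℝ) {r s : ℤ} {m n : ℝ} {T : Set (ℝ × ℝ)}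

/-- On the cell the positive parts are linear, so the first derivatives are affine functions of `u`
and `v`, and each second derivative is a slope. -/
theorem second_partials_apply (hab : a < b) (hcd : c < d) (hrs : P.IsBox r s)
    (hT : ∀ p ∈ T, p ∈ P.box r s ∧
      max 0 ((P.coord r s p).1 - (P.coord r s p).2)
        = m * ((P.coord r s p).1 - (P.coord r s p).2) ∧
      max 0 ((P.coord r s p).1 + (P.coord r s p).2 - 1)
        = n * ((P.coord r s p).1 + (P.coord r s p).2 - 1)) {p : ℝ × ℝ} (hp : p ∈ interior T) :
    partialX a b (partialX a b (Q.apply P f)) p =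
        splUU (P.net (fun i j => Q.coeff P i j f) r s) m n / P.X.h r / P.X.h r ∧
      partialX a b (partialY c d (Q.apply P f)) p =
        splUV (P.net (fun i j => Q.coeff P i j f) r s) m n / P.X.h r / P.Y.h s ∧
      partialY c d (partialY c d (Q.apply P f)) p =
        splVV (P.net (fun i j => Q.coeff P i j f) r s) m n / P.Y.h s / P.Y.h s := by
  set w := P.net (fun i j => Q.coeff P i j f) r s with hw
  have hsub : interior T ⊆ rect a b c d := fun q hq =>
    P.box_subset_rect r s (hT q (interior_subset hq)).1
  set u : ℝ × ℝ → ℝ := fun q => (q.1 - P.X.x (r - 1)) / P.X.h r with hu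
  set v : ℝ × ℝ → ℝ := fun q => (q.2 - P.Y.x (s - 1)) / P.Y.h s with hv
  have hX : Set.EqOn (partialX a b (Q.apply P f)) (fun q => splU w (u q) (v q)
      (m * (u q - v q)) (n * (u q + v q - 1)) / P.X.h r) (interior T) := fun q hq => by
    obtain ⟨h1, h2, h3⟩ := hT q (interior_subset hq)
    rw [Q.partialX_apply f hab hcd hrs h1, pieceX, h2, h3]
    rfl
  have hY : Set.EqOn (partialY c d (Q.apply P f)) (fun q => splV w (u q) (v q)
      (m * (u q - v q)) (n * (u q + v q - 1)) / P.Y.h s) (interior T) := fun q hq => by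
    obtain ⟨h1, h2, h3⟩ := hT q (interior_subset hq)
    rw [Q.partialY_apply f hab hcd hrs h1, pieceY, h2, h3]
    rfl
  -- The constant `k` of each affine function is its value at coordinate `0` in the variable of
  -- differentiation.
  refine ⟨partialX_of_eqOn hab isOpen_interior hsub hX hp
      (k := splU w (u (0, p.2)) (v p) (m * (u (0, p.2) - v p)) (n * (u (0, p.2) + v p - 1))
        / P.X.h r) fun t => ?_,
    partialX_of_eqOn hab isOpen_interior hsub hY hp
      (k := splV w (u (0, p.2)) (v p) (m * (u (0, p.2) - v p)) (n * (u (0, p.2) + v p - 1))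
        / P.Y.h s) fun t => ?_,
    partialY_of_eqOn hcd isOpen_interior hsub hY hp
      (k := splV w (u p) (v (p.1, 0)) (m * (u p - v (p.1, 0))) (n * (u p + v (p.1, 0) - 1))
        / P.Y.h s) fun t => ?_⟩
  · simp only [hu, hv, splU, splUU]; ring
  · simp only [hu, hv, splV, splUV]; ring
  · simp only [hu, hv, splV, splVV]; ring

theorem contDiffOn_apply_interior (hab : a < b) (hcd : c < d) (hrs : P.IsBox r s)
    (hT : ∀ p ∈ T, p ∈ P.box r s ∧
      max 0 ((P.coord r s p).1 - (P.coord r s p).2)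
        = m * ((P.coord r s p).1 - (P.coord r s p).2) ∧
      max 0 ((P.coord r s p).1 + (P.coord r s p).2 - 1)
        = n * ((P.coord r s p).1 + (P.coord r s p).2 - 1)) :
    ContDiffOn ℝ 2 (Q.apply P f) (interior T) := by
  set w := P.net (fun i j => Q.coeff P i j f) r s with hw
  set u : ℝ × ℝ → ℝ := fun q => (q.1 - P.X.x (r - 1)) / P.X.h r with hu
  set v : ℝ × ℝ → ℝ := fun q => (q.2 - P.Y.x (s - 1)) / P.Y.h s with hv
  have cu : ContDiff ℝ 2 u := by fun_prop
  have cv : ContDiff ℝ 2 v := by fun_prop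
  have h : ContDiff ℝ 2 fun q => w 0 * (1 - u q - v q) ^ 2 + w 2 * (v q - u q) ^ 2
      + (w 4 + w 5 + w 6 + w 7) * u q ^ 2
      + 2 * w 6 * ((1 - u q - v q) * (v q - u q)) + 2 * (w 4 + w 6) * ((1 - u q - v q) * u q)
      + 2 * (w 5 + w 6) * ((v q - u q) * u q)
      + jumpMain w * (m * (u q - v q)) ^ 2 + jumpAnti w * (n * (u q + v q - 1)) ^ 2 := by
    clear_value u v
    fun_prop
  refine h.contDiffOn.congr fun q hq => ?_
  obtain ⟨h1, h2, h3⟩ := hT q (interior_subset hq)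
  rw [Q.apply_eq_piece f hab hcd hrs h1, piece, spl, h2, h3]
  rfl

end second

end Grid

/-! ### Error bounds -/

section estimates

variable {a b c d : ℝ} {f : ℝ × ℝ → ℝ} {p z : ℝ × ℝ} {H : ℝ}

theorem abs_partialD_sub_le (hab : a < b) (hcd : c < d) {s : ℕ}
    (hf : ContDiffOn ℝ s f (rect a b c d)) {α : ℕ × ℕ} (hα : α.1 + α.2 = s)
    (hp : p ∈ rect a b c d) (hz : z ∈ rect a b c d) (h1 : |z.1 - p.1| ≤ 3 * H)
    (h2 : |z.2 - p.2| ≤ 3 * H) :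
    |partialD a b c d α f z - partialD a b c d α f p| ≤ 12 * modulusD a b c d s f (H / 2) := by
  -- The coordinate differences add up to at most `6 * H`, which is 12 steps of `H / 2`.
  have := abs_sub_le_mul_modulus (continuousOn_partialD hab hcd hα hf) hz hp (t := H / 2) (N := 12)
    (by norm_num) (by push_cast; linarith)
  push_cast at this
  exact this.trans (mul_le_mul_of_nonneg_left (modulus_le_modulusD hα _) (by norm_num))

theorem abs_sub_quad_one_le (hab : a < b) (hcd : c < d) (hf : ContDiffOn ℝ 1 f (rect a b c d))
    (hp : p ∈ rect a b c d) (hz : z ∈ rect a b c d) (h1 : |z.1 - p.1| ≤ 3 * H)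
    (h2 : |z.2 - p.2| ≤ 3 * H) :
    |f z - quad (f p) (partialX a b f p) (partialY c d f p) 0 0 0 p z|
      ≤ 72 * H * modulusD a b c d 1 f (H / 2) := by
  have hf' : ContDiffOn ℝ ((1 : ℕ) : WithTop ℕ∞) f (rect a b c d) := by exact_mod_cast hf
  have := abs_sub_taylor_one_le hab hcd (hf.differentiableOn (by norm_num)) hp hz h1 h2
    (fun w hw w1 w2 => abs_partialD_sub_le (α := (1, 0)) hab hcd hf' rfl hp hw w1 w2)
    (fun w hw w1 w2 => abs_partialD_sub_le (α := (0, 1)) hab hcd hf' rfl hp hw w1 w2)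
  refine le_trans (le_of_eq ?_) (this.trans (le_of_eq (by ring)))
  congr 1
  simp only [quad]; ring

/-- With `M = 12 ω` and `ρ = 3 H` the Taylor error `3 M ρ²` is `324 H² ω`; at first order `2 M ρ`
gives 72. -/
theorem abs_sub_quad_two_le (hab : a < b) (hcd : c < d) (hf : ContDiffOn ℝ 2 f (rect a b c d))
    (hp : p ∈ rect a b c d) (hz : z ∈ rect a b c d) (h1 : |z.1 - p.1| ≤ 3 * H)
    (h2 : |z.2 - p.2| ≤ 3 * H) :
    |f z - quad (f p) (partialX a b f p) (partialY c d f p) (partialX a b (partialX a b f) p)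
        (partialX a b (partialY c d f) p) (partialY c d (partialY c d f) p) p z|
      ≤ 324 * H ^ 2 * modulusD a b c d 2 f (H / 2) := by
  have hf' : ContDiffOn ℝ ((2 : ℕ) : WithTop ℕ∞) f (rect a b c d) := by exact_mod_cast hf
  have := abs_sub_taylor_two_le hab hcd hf hp hz h1 h2
    (fun w hw w1 w2 => abs_partialD_sub_le (α := (2, 0)) hab hcd hf' rfl hp hw w1 w2)
    (fun w hw w1 w2 => abs_partialD_sub_le (α := (1, 1)) hab hcd hf' rfl hp hw w1 w2)
    (fun w hw w1 w2 => abs_partialD_sub_le (α := (0, 2)) hab hcd hf' rfl hp hw w1 w2)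
  refine le_trans (le_of_eq ?_) (this.trans (le_of_eq (by ring)))
  rfl

theorem abs_sub_add_div_le {e x w K h H γ : ℝ} (hh : 0 < h) (hH : 0 < H) (hγ : H ≤ γ * h)
    (hx : x = e * h + w) (hw : |w| ≤ K) : |e - x / h| ≤ γ * K / H := by
  have hK : 0 ≤ K := (abs_nonneg _).trans hw
  rw [hx, show e - (e * h + w) / h = -(w / h) by field_simp; ring, abs_neg, abs_div,
    abs_of_pos hh, div_le_div_iff₀ hh hH]
  nlinarith [mul_le_mul_of_nonneg_right hw hH.le, mul_le_mul_of_nonneg_left hγ hK]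

theorem abs_sub_add_div_div_le {e x w K h k H γ : ℝ} (hh : 0 < h) (hk : 0 < k) (hH : 0 < H)
    (hγ : H ≤ γ * h) (hγ' : H ≤ γ * k) (hx : x = e * h * k + w) (hw : |w| ≤ K) :
    |e - x / h / k| ≤ γ ^ 2 * K / H ^ 2 := by
  have := abs_sub_add_div_le (mul_pos hh hk) (pow_pos hH 2) (γ := γ ^ 2) (e := e) (x := x)
    (by nlinarith [mul_le_mul hγ hγ' hH.le (hH.le.trans hγ)]) (by rw [hx]; ring) hw
  rwa [← div_div] at this

variable {P : Grid a b c d} {γ : ℝ}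

theorem Grid.maxStep_pos (P : Grid a b c d) (hab : a < b) : 0 < P.maxStep :=
  (P.X.maxStep_pos hab).trans_le (le_max_left _ _)

theorem Grid.maxStep_le_mul (hab : a < b) (hcd : c < d) (hγ : 0 < γ)
    (hP : P.maxStep / P.minStep ≤ γ) {r s : ℤ} (hrs : P.IsBox r s) :
    P.maxStep ≤ γ * P.X.h r ∧ P.maxStep ≤ γ * P.Y.h s := by
  have h0 : 0 < P.minStep := lt_min (P.X.minStep_pos hab) (P.Y.minStep_pos hcd)
  have h1 := (div_le_iff₀ h0).1 hP
  exact ⟨h1.trans (mul_le_mul_of_nonneg_left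
      ((min_le_left _ _).trans (P.X.minStep_le_h hrs.1.1 hrs.1.2)) hγ.le),
    h1.trans (mul_le_mul_of_nonneg_left
      ((min_le_right _ _).trans (P.Y.minStep_le_h hrs.2.1 hrs.2.2)) hγ.le)⟩

theorem Grid.exists_net_coeff_eq_of_near (Q : Kind) (hab : a < b) (hcd : c < d) {r s : ℤ}
    (hrs : P.IsBox r s) (hp : p ∈ P.box r s) (e e₁ e₂ e₁₁ e₁₂ e₂₂ : ℝ) {K : ℝ}
    (hf : ∀ z ∈ rect a b c d, |z.1 - p.1| ≤ 3 * P.maxStep → |z.2 - p.2| ≤ 3 * P.maxStep →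
      |f z - quad e e₁ e₂ e₁₁ e₁₂ e₂₂ p z| ≤ K) :
    ∃ w : Fin 8 → ℝ, (∀ l, |w l| ≤ 9 * K) ∧ P.net (fun i j => Q.coeff P i j f) r s =
      quadNet e e₁ e₂ e₁₁ e₁₂ e₂₂ (-(P.X.h r * P.X.coord r p.1))
        (P.X.h r * (1 - P.X.coord r p.1)) (-(P.Y.h s * P.Y.coord s p.2))
        (P.Y.h s * (1 - P.Y.coord s p.2)) + w :=
  Grid.exists_net_coeff_eq Q hab hcd hrs e e₁ e₂ e₁₁ e₁₂ e₂₂ fun z hz1 hz2 => hf z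
    ⟨⟨(P.X.x_mem _).1.trans hz1.1, hz1.2.trans (P.X.x_mem _).2⟩,
      ⟨(P.Y.x_mem _).1.trans hz2.1, hz2.2.trans (P.Y.x_mem _).2⟩⟩
    (P.X.abs_sub_le_of_mem_window hab (le_max_left _ _) hz1 hp.1)
    (P.Y.abs_sub_le_of_mem_window hcd (le_max_right _ _) hz2 hp.2)

/-- The second-order coefficients of the comparison polynomial are free, since its gradient at `p`
does not see them: they are zero for `s = 1` and the second derivatives of `f` for `s = 2`. The
factor 900 is 100 from the derivative bound times 9 from the functional. -/
theorem Kind.first_partials_le (Q : Kind) (hab : a < b) (hcd : c < d) (hγ : 0 < γ)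
    (hP : P.maxStep / P.minStep ≤ γ) (hp : p ∈ rect a b c d) {e₁₁ e₁₂ e₂₂ K : ℝ}
    (hf : ∀ z ∈ rect a b c d, |z.1 - p.1| ≤ 3 * P.maxStep → |z.2 - p.2| ≤ 3 * P.maxStep →
      |f z - quad (f p) (partialX a b f p) (partialY c d f p) e₁₁ e₁₂ e₂₂ p z| ≤ K)
    {α : ℕ × ℕ} (hα : α.1 + α.2 = 1) :
    |partialD a b c d α f p - partialD a b c d α (Q.apply P f) p|
      ≤ γ * (900 * K) / P.maxStep := by
  have hrs := P.isBox_cell hab hcd hp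
  have hpb := P.mem_box_cell hab hcd hp
  set r := P.X.cell p.1
  set s := P.Y.cell p.2
  obtain ⟨w, hw, hnet⟩ := P.exists_net_coeff_eq_of_near Q hab hcd hrs hpb _ _ _ _ _ _ hf
  obtain ⟨g1, g2⟩ := P.maxStep_le_mul hab hcd hγ hP hrs
  have hH := P.maxStep_pos hab
  have hu := P.X.coord_mem hrs.1.1 hrs.1.2 hpb.1
  have hv := P.Y.coord_mem hrs.2.1 hrs.2.2 hpb.2
  set u := P.X.coord r p.1 with hu'
  set v := P.Y.coord s p.2 with hv'
  have hm : |max 0 (u - v)| ≤ 1 := by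
    rw [abs_of_nonneg (le_max_left _ _)]
    exact max_le zero_le_one (by linarith [hu.2, hv.1])
  have hn : |max 0 (u + v - 1)| ≤ 1 := by
    rw [abs_of_nonneg (le_max_left _ _)]
    exact max_le zero_le_one (by linarith [hu.2, hv.2])
  obtain ⟨α₁, α₂⟩ := α
  rcases (by simp at hα; omega : α₁ = 1 ∧ α₂ = 0 ∨ α₁ = 0 ∧ α₂ = 1) with ⟨rfl, rfl⟩ | ⟨rfl, rfl⟩
  · change |partialX a b f p - partialX a b (Q.apply P f) p| ≤ _
    rw [Q.partialX_apply f hab hcd hrs hpb]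
    refine abs_sub_add_div_le (w := splU w u v (max 0 (u - v)) (max 0 (u + v - 1)))
      (P.X.h_pos hrs.1.1 hrs.1.2) hH g1 ?_
      ((abs_splU_le hw hu hv hm hn).trans (by linarith))
    change splU _ u v (max 0 (u - v)) (max 0 (u + v - 1)) = _
    rw [hnet, splU_add, splU_quadNet]
  · change |partialY c d f p - partialY c d (Q.apply P f) p| ≤ _
    rw [Q.partialY_apply f hab hcd hrs hpb]
    refine abs_sub_add_div_le (w := splV w u v (max 0 (u - v)) (max 0 (u + v - 1)))
      (P.Y.h_pos hrs.2.1 hrs.2.2) hH g2 ?_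
      ((abs_splV_le hw hu hv hm hn).trans (by linarith))
    change splV _ u v (max 0 (u - v)) (max 0 (u + v - 1)) = _
    rw [hnet, splV_add, splV_quadNet]

theorem Kind.second_partials_le (Q : Kind) (hab : a < b) (hcd : c < d) (hγ : 0 < γ)
    (hP : P.maxStep / P.minStep ≤ γ) {T : Set (ℝ × ℝ)} (hT : P.IsCell T) (hp : p ∈ interior T)
    {K : ℝ}
    (hf : ∀ z ∈ rect a b c d, |z.1 - p.1| ≤ 3 * P.maxStep → |z.2 - p.2| ≤ 3 * P.maxStep →
      |f z - quad (f p) (partialX a b f p) (partialY c d f p) (partialX a b (partialX a b f) p)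
        (partialX a b (partialY c d f) p) (partialY c d (partialY c d f) p) p z| ≤ K)
    {α : ℕ × ℕ} (hα : α.1 + α.2 = 2) :
    |partialD a b c d α f p - partialD a b c d α (Q.apply P f) p|
      ≤ γ ^ 2 * (900 * K) / P.maxStep ^ 2 := by
  obtain ⟨r, s, m, n, hrs, hm, hn, hT⟩ := hT.exists_box
  have hpb := (hT p (interior_subset hp)).1
  obtain ⟨w, hw, hnet⟩ := P.exists_net_coeff_eq_of_near Q hab hcd hrs hpb _ _ _ _ _ _ hf
  obtain ⟨g1, g2⟩ := P.maxStep_le_mul hab hcd hγ hP hrs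
  have hH := P.maxStep_pos hab
  have hX := P.X.h_pos hrs.1.1 hrs.1.2
  have hY := P.Y.h_pos hrs.2.1 hrs.2.2
  obtain ⟨dXX, dXY, dYY⟩ := Grid.second_partials_apply Q f hab hcd hrs hT hp
  obtain ⟨α₁, α₂⟩ := α
  rcases (by simp at hα; omega : α₁ = 2 ∧ α₂ = 0 ∨ α₁ = 1 ∧ α₂ = 1 ∨ α₁ = 0 ∧ α₂ = 2) with
    ⟨rfl, rfl⟩ | ⟨rfl, rfl⟩ | ⟨rfl, rfl⟩
  · change |partialX a b (partialX a b f) p - partialX a b (partialX a b (Q.apply P f)) p| ≤ _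
    rw [dXX, hnet]
    exact abs_sub_add_div_div_le hX hX hH g1 g1 (by rw [splUU_add, splUU_quadNet])
      ((abs_splUU_le hw hm hn).trans (by linarith))
  · change |partialX a b (partialY c d f) p - partialX a b (partialY c d (Q.apply P f)) p| ≤ _
    rw [dXY, hnet]
    exact abs_sub_add_div_div_le hX hY hH g1 g2 (by rw [splUV_add, splUV_quadNet])
      ((abs_splUV_le hw hm hn).trans (by linarith))
  · change |partialY c d (partialY c d f) p - partialY c d (partialY c d (Q.apply P f)) p| ≤ _
    rw [dYY, hnet]
    exact abs_sub_add_div_div_le hY hY hH g2 g2 (by rw [splVV_add, splVV_quadNet])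
      ((abs_splVV_le hw hm hn).trans (by linarith))

/-- The constant is `291600 = 900 * 324`. It also covers `s = 1`, where `900 * 72` would do, and `γ
≤ γ ^ 2` lets the same constant serve for both orders of differentiation. -/
theorem Kind.first_error_le (Q : Kind) (hab : a < b) (hcd : c < d) (hγ : 1 < γ)
    (hP : P.maxStep / P.minStep ≤ γ) {s : ℕ} (hs : s = 1 ∨ s = 2)
    (hf : ContDiffOn ℝ s f (rect a b c d)) {α : ℕ × ℕ} (hα : α.1 + α.2 = 1)
    (hp : p ∈ rect a b c d) :
    |partialD a b c d α f p - partialD a b c d α (Q.apply P f) p| ≤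
      291600 * γ ^ 2 * (P.maxStep ^ (s - 1) * modulusD a b c d s f (P.maxStep / 2)) := by
  have hγ0 : 0 < γ := by linarith
  have hH := P.maxStep_pos hab
  have hω := modulusD_nonneg (a := a) (b := b) (c := c) (d := d) (f := f) s (P.maxStep / 2)
  have hγγ : γ ≤ γ ^ 2 := by nlinarith
  rcases hs with rfl | rfl
  · have := Q.first_partials_le (f := f) hab hcd hγ0 hP hp (e₁₁ := 0) (e₁₂ := 0) (e₂₂ := 0)
      (fun z hz h1 h2 => abs_sub_quad_one_le hab hcd (by exact_mod_cast hf) hp hz h1 h2) hα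
    refine this.trans ?_
    rw [div_le_iff₀ hH, Nat.sub_self, pow_zero, one_mul]
    nlinarith [mul_le_mul_of_nonneg_right hγγ (mul_nonneg hω hH.le),
      mul_nonneg (sq_nonneg γ) (mul_nonneg hω hH.le)]
  · have := Q.first_partials_le (f := f) hab hcd hγ0 hP hp (e₁₁ := partialX a b (partialX a b f) p)
      (e₁₂ := partialX a b (partialY c d f) p) (e₂₂ := partialY c d (partialY c d f) p)
      (fun z hz h1 h2 => abs_sub_quad_two_le hab hcd (by exact_mod_cast hf) hp hz h1 h2) hα
    refine this.trans ?_
    rw [div_le_iff₀ hH, show 2 - 1 = 1 from rfl, pow_one]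
    nlinarith [mul_le_mul_of_nonneg_right hγγ (mul_nonneg hω (mul_nonneg hH.le hH.le))]

theorem Kind.second_error_le (Q : Kind) (hab : a < b) (hcd : c < d) (hγ : 1 < γ)
    (hP : P.maxStep / P.minStep ≤ γ) (hf : ContDiffOn ℝ 2 f (rect a b c d)) {T : Set (ℝ × ℝ)}
    (hT : P.IsCell T) (hp : p ∈ interior T) {α : ℕ × ℕ} (hα : α.1 + α.2 = 2) :
    |partialD a b c d α f p - partialD a b c d α (Q.apply P f) p| ≤
      291600 * γ ^ 2 * modulusD a b c d 2 f (P.maxStep / 2) := by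
  have hH := P.maxStep_pos hab
  have hp' : p ∈ rect a b c d := by
    obtain ⟨r, s, m, n, -, -, -, h⟩ := hT.exists_box
    exact P.box_subset_rect r s (h p (interior_subset hp)).1
  have := Q.second_partials_le (f := f) hab hcd (by linarith) hP hT hp
    (fun z hz h1 h2 => abs_sub_quad_two_le hab hcd hf hp' hz h1 h2) hα
  refine this.trans (le_of_eq ?_)
  field_simp
  ring

end estimates

end CrissCross

theorem theorem7 (Q : Kind) (γ : ℝ) (hγ : 1 < γ) :
    ∃ C : ℝ, 0 < C ∧
      ∀ (a b c d : ℝ), a < b → c < d →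
      ∀ (ι : Type) (P : ι → Grid a b c d), QuasiUniform γ P →
      ∀ f : ℝ × ℝ → ℝ,
        -- the bounds for `|α| = 1`, together with the smoothness of `Q f` that they presuppose
        (∀ s : ℕ, s = 1 ∨ s = 2 → ContDiffOn ℝ s f (rect a b c d) → ∀ k : ι,
          ContDiffOn ℝ 1 (Q.apply (P k) f) (rect a b c d) ∧
          ∀ α : ℕ × ℕ, α.1 + α.2 = 1 → ∀ p ∈ rect a b c d,
            |partialD a b c d α f p - partialD a b c d α (Q.apply (P k) f) p| ≤
              C * ((P k).maxStep ^ (s - 1) * modulusD a b c d s f ((P k).maxStep / 2))) ∧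
        -- the bound for `|α| = 2` inside the triangular cells
        (ContDiffOn ℝ 2 f (rect a b c d) → ∀ k : ι, ∀ T : Set (ℝ × ℝ), (P k).IsCell T →
          ContDiffOn ℝ 2 (Q.apply (P k) f) (interior T) ∧
          ∀ α : ℕ × ℕ, α.1 + α.2 = 2 → ∀ p ∈ interior T,
            |partialD a b c d α f p - partialD a b c d α (Q.apply (P k) f) p| ≤
              C * modulusD a b c d 2 f ((P k).maxStep / 2)) ∧
        -- convergence as the maximal steplength tends to zero
        (∀ l : Filter ι, Tendsto (fun k => (P k).maxStep) l (𝓝 0) →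
          (ContDiffOn ℝ 1 f (rect a b c d) → ∀ α : ℕ × ℕ, α.1 + α.2 = 1 →
            TendstoUniformlyOn (fun k => partialD a b c d α (Q.apply (P k) f))
              (partialD a b c d α f) l (rect a b c d)) ∧
          (ContDiffOn ℝ 2 f (rect a b c d) → ∀ α : ℕ × ℕ, α.1 + α.2 = 2 →
            ∀ ε > 0, ∀ᶠ k in l, ∀ T : Set (ℝ × ℝ), (P k).IsCell T → ∀ p ∈ interior T,
              |partialD a b c d α f p - partialD a b c d α (Q.apply (P k) f) p| < ε)) := by
  have hC : 0 < 291600 * γ ^ 2 := by positivity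
  refine ⟨291600 * γ ^ 2, hC, fun a b c d hab hcd ι P hP f => ⟨fun s hs hf k => ?_,
    fun hf k T hT => ?_, fun l hl => ?_⟩⟩
  · exact ⟨Q.contDiffOn_apply f hab hcd, fun α hα p hp =>
      Q.first_error_le hab hcd hγ (hP k) hs hf hα hp⟩
  · obtain ⟨r, s, m, n, hrs, -, -, h⟩ := hT.exists_box
    exact ⟨Grid.contDiffOn_apply_interior Q f hab hcd hrs h, fun α hα p hp =>
      Q.second_error_le hab hcd hγ (hP k) hf hT hp hα⟩
  · have small : ∀ s : ℕ, ContDiffOn ℝ s f (rect a b c d) → ∀ ε > 0, ∀ᶠ k in l,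
        291600 * γ ^ 2 * modulusD a b c d s f ((P k).maxStep / 2) < ε := by
      intro s hf ε hε
      -- Halving `ε` makes the final inequality strict; the modulus is taken at `H / 2`, so `H < 2 *
      -- τ` is enough.
      obtain ⟨τ, hτ, h⟩ := exists_modulusD_le hab hcd hf (ε := ε / 2 / (291600 * γ ^ 2))
        (by positivity)
      filter_upwards [hl.eventually_lt_const (u := 2 * τ) (by positivity)] with k hk
      have := mul_le_mul_of_nonneg_left (h ((P k).maxStep / 2) (by linarith)) hC.le
      rw [mul_div_cancel₀ _ hC.ne'] at this
      linarith
    refine ⟨fun hf α hα => ?_, fun hf α hα ε hε => ?_⟩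
    · rw [Metric.tendstoUniformlyOn_iff]
      intro ε hε
      filter_upwards [small 1 (by exact_mod_cast hf) ε hε] with k hk p hp
      have := Q.first_error_le hab hcd hγ (hP k) (Or.inl rfl) (by exact_mod_cast hf) hα hp
      rw [Nat.sub_self, pow_zero, one_mul] at this
      exact this.trans_lt hk
    · filter_upwards [small 2 (by exact_mod_cast hf) ε hε] with k hk T hT p hp
      exact (Q.second_error_le hab hcd hγ (hP k) hf hT hp hα).trans_lt hk
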